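/- Let $\mathbb{K}$ be a field and let $q\in\mathbb{K}\setminus\{0\}$ be an element which is not a root of unity. Let $\mathcal{A}$ be the quantum spatial ageing algebra, i.e. the associative unital $\mathbb{K}$-algebra generated by $E, K, K^{-1}, X, Y$ subject to the defining relations $KK^{-1}=K^{-1}K=1$ and $$EK=q^{-2}KE,\quad XK=q^{-1}KX,\quad YK=qKY,\quad EX=qXE,\quad EY=X+q^{-1}YE,\quad qYX=XY.$$ Put $\varphi = X+(q^{-1}-q)YE\in\mathcal{A}$. Let $Z$ be the class of $\varphi YK^{-1}$ in the factor algebra $\mathcal{A}/(X)$ and let $C$ be the class of $XYK$ in the factor algebra $\mathcal{A}/(\varphi)$, and let $\mathbb{K}[K,K^{-1}]\subseteq\mathcal{A}$, $\mathbb{K}[Z]\subseteq\mathcal{A}/(X)$ and $\mathbb{K}[C]\subseteq\mathcal{A}/(\varphi)$ be the (commutative) subalgebras generated by $K,K^{-1}$, by $Z$ and by $C$, respectively. For an ideal $\mathfrak{p}$ of $\mathbb{K}[K,K^{-1}]$ let $(Y,E,\mathfrak{p})$ be the two-sided ideal of $\mathcal{A}$ generated by $Y$, $E$ and $\mathfrak{p}$;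 for an ideal $\mathfrak{q}$ of $\mathbb{K}[Z]$ (respectively $\mathfrak{r}$ of $\mathbb{K}[C]$) let $(X,\mathfrak{q})$ (respectively $(\varphi,\mathfrak{r})$) be the preimage in $\mathcal{A}$ of the two-sided ideal of $\mathcal{A}/(X)$ generated by $\mathfrak{q}$ (respectively of $\mathcal{A}/(\varphi)$ generated by $\mathfrak{r}$). Let $\operatorname{Max}$ denote the set of maximal two-sided ideals of an algebra. Then $\operatorname{Max}(\mathcal{A})$ is the disjoint union $$\operatorname{Max}(\mathcal{A})=\mathcal{P}\sqcup\mathcal{Q}\sqcup\mathcal{R},$$ where $$\mathcal{P}=\{(Y,E,\mathfrak{p}) \mid \mathfrak{p}\in\operatorname{Max}(\mathbb{K}[K,K^{-1}])\},\quad \mathcal{Q}=\{(X,\mathfrak{q}) \mid \mathfrak{q}\in\operatorname{Max}(\mathbb{K}[Z])\setminus\{(Z)\}\},\quad \mathcal{R}=\{(\varphi,\mathfrak{r}) \mid \mathfrak{r}\in\operatorname{Max}(\mathbb{K}[C])\setminus\{(C)\}\}.$$ -/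

import Mathlib

namespace QuantumAgeing

/-- Names of the five generators of the quantum spatial ageing algebra. -/
inductive Gen : Type
  | E | K | Kinv | X | Y

/-- The defining relations of the quantum spatial ageing algebra, imposed on the free
associative algebra on the generators `E, K, K⁻¹, X, Y`. -/
inductive Rel (F : Type*) [Field F] (q : F) : FreeAlgebra F Gen → FreeAlgebra F Gen → Prop
  | K_mul_Kinv : Rel F q (FreeAlgebra.ι F Gen.K * FreeAlgebra.ι F Gen.Kinv) 1
  | Kinv_mul_K : Rel F q (FreeAlgebra.ι F Gen.Kinv * FreeAlgebra.ι F Gen.K) 1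
  | E_mul_K : Rel F q (FreeAlgebra.ι F Gen.E * FreeAlgebra.ι F Gen.K)
      ((q⁻¹ ^ 2) • (FreeAlgebra.ι F Gen.K * FreeAlgebra.ι F Gen.E))
  | X_mul_K : Rel F q (FreeAlgebra.ι F Gen.X * FreeAlgebra.ι F Gen.K)
      (q⁻¹ • (FreeAlgebra.ι F Gen.K * FreeAlgebra.ι F Gen.X))
  | Y_mul_K : Rel F q (FreeAlgebra.ι F Gen.Y * FreeAlgebra.ι F Gen.K)
      (q • (FreeAlgebra.ι F Gen.K * FreeAlgebra.ι F Gen.Y))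
  | E_mul_X : Rel F q (FreeAlgebra.ι F Gen.E * FreeAlgebra.ι F Gen.X)
      (q • (FreeAlgebra.ι F Gen.X * FreeAlgebra.ι F Gen.E))
  | E_mul_Y : Rel F q (FreeAlgebra.ι F Gen.E * FreeAlgebra.ι F Gen.Y)
      (FreeAlgebra.ι F Gen.X + q⁻¹ • (FreeAlgebra.ι F Gen.Y * FreeAlgebra.ι F Gen.E))
  | Y_mul_X : Rel F q (q • (FreeAlgebra.ι F Gen.Y * FreeAlgebra.ι F Gen.X))
      (FreeAlgebra.ι F Gen.X * FreeAlgebra.ι F Gen.Y)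

/-- The quantum spatial ageing algebra over the field `F` with parameter `q`. -/
abbrev Alg (F : Type*) [Field F] (q : F) : Type _ := RingQuot (Rel F q)

section Elements

variable (F : Type*) [Field F] (q : F)

/-- The image of a generator in the algebra. -/
def gen (g : Gen) : Alg F q := RingQuot.mkAlgHom F (Rel F q) (FreeAlgebra.ι F g)

/-- The generator `E`. -/
def elE : Alg F q := gen F q Gen.E

/-- The generator `K`. -/
def elK : Alg F q := gen F q Gen.K

/-- The generator `K⁻¹`. -/
def elKinv : Alg F q := gen F q Gen.Kinv

/-- The generator `X`. -/
def elX : Alg F q := gen F q Gen.X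

/-- The generator `Y`. -/
def elY : Alg F q := gen F q Gen.Y

/-- The normal element `φ = X + (q⁻¹ - q) Y E`. -/
def elPhi : Alg F q := elX F q + (q⁻¹ - q) • (elY F q * elE F q)

/-- The ideal `(X)`. -/
def idealX : TwoSidedIdeal (Alg F q) := TwoSidedIdeal.span {elX F q}

/-- The ideal `(φ)`. -/
def idealPhi : TwoSidedIdeal (Alg F q) := TwoSidedIdeal.span {elPhi F q}

/-- The element `Z = φ Y K⁻¹` of the factor algebra modulo `(X)`. -/
def elZ : (idealX F q).ringCon.Quotient :=
  (idealX F q).ringCon.mk' (elPhi F q * elY F q * elKinv F q)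

/-- The element `C = X Y K` of the factor algebra modulo `(φ)`. -/
def elC : (idealPhi F q).ringCon.Quotient :=
  (idealPhi F q).ringCon.mk' (elX F q * elY F q * elK F q)

/-- `F[K, K⁻¹]`, the subalgebra generated by `K` and `K⁻¹`. -/
abbrev algK : Subalgebra F (Alg F q) := Algebra.adjoin F {elK F q, elKinv F q}

/-- `F[Z]`, the subalgebra of the factor algebra modulo `(X)` generated by `Z`. -/
abbrev algZ : Subalgebra F (idealX F q).ringCon.Quotient := Algebra.adjoin F {elZ F q}

/-- `F[C]`, the subalgebra of the factor algebra modulo `(φ)` generated by `C`. -/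
abbrev algC : Subalgebra F (idealPhi F q).ringCon.Quotient := Algebra.adjoin F {elC F q}

/-- `(Y, E, 𝔭)`: the two-sided ideal generated by `Y`, `E` and the elements of `𝔭`. -/
def idealYE (𝔭 : Ideal (algK F q)) : TwoSidedIdeal (Alg F q) :=
  TwoSidedIdeal.span ({elY F q, elE F q} ∪ Subtype.val '' (𝔭 : Set (algK F q)))

/-- `(X, 𝔮)`: the preimage of the two-sided ideal that the elements of `𝔮 ⊆ F[Z]` generate in the
factor algebra modulo `(X)`. -/
def idealXq (𝔮 : Ideal (algZ F q)) : TwoSidedIdeal (Alg F q) :=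
  TwoSidedIdeal.comap (idealX F q).ringCon.mk'
    (TwoSidedIdeal.span (Subtype.val '' (𝔮 : Set (algZ F q))))

/-- `(φ, 𝔯)`: the preimage of the two-sided ideal that the elements of `𝔯 ⊆ F[C]` generate in the
factor algebra modulo `(φ)`. -/
def idealPhir (𝔯 : Ideal (algC F q)) : TwoSidedIdeal (Alg F q) :=
  TwoSidedIdeal.comap (idealPhi F q).ringCon.mk'
    (TwoSidedIdeal.span (Subtype.val '' (𝔯 : Set (algC F q))))

/-- The set of maximal (two-sided) ideals. -/
def maxIdeals : Set (TwoSidedIdeal (Alg F q)) := {M | IsCoatom M}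

/-- The family of the ideals `(Y, E, 𝔭)` with `𝔭` a maximal ideal of `F[K, K⁻¹]`. -/
def familyP : Set (TwoSidedIdeal (Alg F q)) :=
  {M | ∃ 𝔭 : Ideal (algK F q), 𝔭.IsMaximal ∧ M = idealYE F q 𝔭}

/-- The family of the ideals `(X, 𝔮)` with `𝔮 ≠ (Z)` a maximal ideal of `F[Z]`. -/
def familyQ : Set (TwoSidedIdeal (Alg F q)) :=
  {M | ∃ 𝔮 : Ideal (algZ F q), 𝔮.IsMaximal ∧
    𝔮 ≠ Ideal.span {⟨elZ F q, Algebra.self_mem_adjoin_singleton F (elZ F q)⟩} ∧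
    M = idealXq F q 𝔮}

/-- The family of the ideals `(φ, 𝔯)` with `𝔯 ≠ (C)` a maximal ideal of `F[C]`. -/
def familyR : Set (TwoSidedIdeal (Alg F q)) :=
  {M | ∃ 𝔯 : Ideal (algC F q), 𝔯.IsMaximal ∧
    𝔯 ≠ Ideal.span {⟨elC F q, Algebra.self_mem_adjoin_singleton F (elC F q)⟩} ∧
    M = idealPhir F q 𝔯}

end Elements

end QuantumAgeing

/-! The engine is weight elimination. If a unit `a` commutes with `v` up to a scalar `c`, then
passing from `x` to `a * x - c • (x * a)` kills the `v`-component of `x` and rescales the others, so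
a two-sided ideal containing a sum of weight vectors also contains its weight-one part
(`mem_of_add_sum_mem`). As `q` is not a root of unity, trivial weight becomes a linear condition on
exponents. In a simple ring every nonzero normal element is a unit and so may serve as `a`
(`isUnit_of_skew`).

Let `M` be maximal. Since `X = EY - q⁻¹YE` and `φ = EY - qYE` are normal, they are zero or units in
the simple quotient. If both were units, then no product of `X` with a monomial in the generators
would have trivial weight for all of `K`, `X`, `φ`, although `1` is a combination of such products;
hence `X ∈ M` or `φ ∈ M` (`x_eq_zero_or_phi_eq_zero`). A similar degree count gives `E ∈ M ↔ Y ∈ M`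
(`e_eq_zero_iff`). If `Y, E ∈ M`, then `X ∈ M` too, and what remains is the commutative algebra
`F[K, K⁻¹]`, a retract of the whole algebra.

Otherwise one works modulo `X` or modulo `φ`. There `E` and `Y` commute up to a scalar, and `Z`,
respectively `C`, is a central element proportional to `Y²EK⁻¹`, respectively `Y²EK`;
`QuantumTriple` treats both cases at once. Given a maximal ideal `N` containing neither `y` nor `e`,
the image of `F[z]` in the quotient is a field, so `N ∩ F[z]` is maximal (`exists_eq_span`).
Conversely, for a maximal `𝔮 ≠ (z)` the quotient by `𝔮`, if nonzero, is spanned by the `k^i y^j`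
over the field `F[z]/𝔮`, and weight elimination makes it simple (`isCoatom_span`). That it is
nonzero is seen from an explicit representation on sequences in which `z` acts by a prescribed
scalar (`one_notMem_span_of_representation`), so no monomial basis of the algebra is ever needed. -/

namespace QuantumAgeing

universe u v w

/-! ### Two-sided ideals under surjections, and simplicity of quotients. -/

section Ideals

variable {R : Type u} {S : Type v} [Ring R] [Ring S]

theorem exists_comap_eq (f : R →+* S) (hf : Function.Surjective f) (M : TwoSidedIdeal R)
    (h : ∀ x, f x = 0 → x ∈ M) : ∃ N : TwoSidedIdeal S, N.comap f = M := by
  refine ⟨TwoSidedIdeal.mk' (f '' (M : Set R)) ⟨0, M.zero_mem, map_zero f⟩ ?_ ?_ ?_ ?_, ?_⟩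
  · rintro _ _ ⟨a, ha, rfl⟩ ⟨b, hb, rfl⟩
    exact ⟨a + b, M.add_mem ha hb, map_add f a b⟩
  · rintro _ ⟨a, ha, rfl⟩
    exact ⟨-a, M.neg_mem ha, map_neg f a⟩
  · rintro x _ ⟨a, ha, rfl⟩
    obtain ⟨b, rfl⟩ := hf x
    exact ⟨b * a, M.mul_mem_left _ _ ha, map_mul f b a⟩
  · rintro _ x ⟨a, ha, rfl⟩
    obtain ⟨b, rfl⟩ := hf x
    exact ⟨a * b, M.mul_mem_right _ _ ha, map_mul f a b⟩
  · ext x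
    rw [TwoSidedIdeal.mem_comap]
    refine Iff.trans (TwoSidedIdeal.mem_mk' _ _ _ _ _ _ _) ?_
    constructor
    · rintro ⟨a, ha, hax⟩
      have := M.add_mem (h (x - a) (by rw [map_sub, hax, sub_self])) ha
      rwa [sub_add_cancel] at this
    · exact fun hx => ⟨x, hx, rfl⟩

theorem comap_le_comap_iff (f : R →+* S) (hf : Function.Surjective f) {N N' : TwoSidedIdeal S} :
    N.comap f ≤ N'.comap f ↔ N ≤ N' := by
  refine ⟨fun h x hx => ?_, fun h x hx => ?_⟩
  · obtain ⟨a, rfl⟩ := hf x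
    exact (TwoSidedIdeal.mem_comap f).1 (h ((TwoSidedIdeal.mem_comap f).2 hx))
  · exact (TwoSidedIdeal.mem_comap f).2 (h ((TwoSidedIdeal.mem_comap f).1 hx))

theorem comap_eq_top_iff (f : R →+* S) {N : TwoSidedIdeal S} : N.comap f = ⊤ ↔ N = ⊤ := by
  rw [← TwoSidedIdeal.one_mem_iff, ← TwoSidedIdeal.one_mem_iff, TwoSidedIdeal.mem_comap, map_one]

theorem isCoatom_comap_iff (f : R →+* S) (hf : Function.Surjective f) {N : TwoSidedIdeal S} :
    IsCoatom (N.comap f) ↔ IsCoatom N := by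
  constructor
  · rintro ⟨h1, h2⟩
    refine ⟨fun h => h1 ((comap_eq_top_iff f).2 h), fun N' hN' => ?_⟩
    rw [← comap_eq_top_iff f]
    refine h2 _ ?_
    rw [lt_iff_le_not_ge] at hN' ⊢
    rwa [comap_le_comap_iff f hf, comap_le_comap_iff f hf]
  · rintro ⟨h1, h2⟩
    refine ⟨fun h => h1 ((comap_eq_top_iff f).1 h), fun M hM => ?_⟩
    obtain ⟨N', rfl⟩ := exists_comap_eq f hf M (fun x hx => hM.le (by
      rw [TwoSidedIdeal.mem_comap, hx]; exact N.zero_mem))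
    rw [comap_eq_top_iff]
    refine h2 _ ?_
    rw [lt_iff_le_not_ge] at hM ⊢
    rwa [comap_le_comap_iff f hf, comap_le_comap_iff f hf] at hM

theorem mk'_eq_zero_iff (M : TwoSidedIdeal R) (x : R) : M.ringCon.mk' x = 0 ↔ x ∈ M := by
  rw [← TwoSidedIdeal.mem_ker, TwoSidedIdeal.ker_ringCon_mk']

theorem comap_mk'_bot (M : TwoSidedIdeal R) :
    (⊥ : TwoSidedIdeal M.ringCon.Quotient).comap M.ringCon.mk' = M := by
  ext x
  rw [TwoSidedIdeal.mem_comap, TwoSidedIdeal.mem_bot, mk'_eq_zero_iff]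

theorem isSimpleRing_quotient_iff (M : TwoSidedIdeal R) :
    IsSimpleRing M.ringCon.Quotient ↔ IsCoatom M := by
  conv_rhs => rw [← comap_mk'_bot M, isCoatom_comap_iff _ M.ringCon.mk'_surjective]
  rw [isSimpleRing_iff, isSimpleOrder_iff_isCoatom_bot]

theorem isSimpleRing_of_one_mem [Nontrivial R]
    (h : ∀ (I : TwoSidedIdeal R) (x : R), x ∈ I → x ≠ 0 → (1 : R) ∈ I) : IsSimpleRing R := by
  refine ⟨⟨fun I => ?_⟩⟩
  by_cases hI : ∃ x ∈ I, x ≠ 0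
  · obtain ⟨x, hx, hx0⟩ := hI
    exact Or.inr ((TwoSidedIdeal.one_mem_iff I).1 (h I x hx hx0))
  · refine Or.inl (le_antisymm (fun x hx => ?_) bot_le)
    push Not at hI
    exact (TwoSidedIdeal.mem_bot R).2 (hI x hx)

end Ideals

/-! ### Commutation up to scalars, weight elimination and normal elements. -/

section Skew

variable {F : Type u} [Field F] {B : Type v} [Ring B] [Algebra F B]

/-- The elements `a` and `b` commute up to the scalar `c`. -/
def Skew (c : F) (a b : B) : Prop := a * b = c • (b * a)

theorem skew_one_iff {a b : B} : Skew (1 : F) a b ↔ Commute a b := by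
  rw [Skew, one_smul]; rfl

theorem Skew.refl (a : B) : Skew (1 : F) a a := skew_one_iff.2 (Commute.refl a)

theorem skew_one_right (a : B) : Skew (1 : F) a 1 := skew_one_iff.2 (Commute.one_right a)

theorem skew_zero_right (c : F) (a : B) : Skew c a 0 := by simp [Skew]

theorem Skew.symm {c : F} (hc : c ≠ 0) {a b : B} (h : Skew c a b) : Skew c⁻¹ b a := by
  rw [Skew, h, smul_smul, inv_mul_cancel₀ hc, one_smul]

theorem Skew.mul_right {c d : F} {a b b' : B} (h : Skew c a b) (h' : Skew d a b') :
    Skew (c * d) a (b * b') := by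
  rw [Skew] at *
  rw [← mul_assoc, h, smul_mul_assoc, mul_assoc, h', mul_smul_comm, smul_smul, mul_assoc]

theorem Skew.mul_left {c d : F} {a a' b : B} (h : Skew c a b) (h' : Skew d a' b) :
    Skew (c * d) (a * a') b := by
  rw [Skew] at *
  rw [mul_assoc, h', mul_smul_comm, ← mul_assoc, h, smul_mul_assoc, smul_smul, mul_assoc, mul_comm d]

theorem Skew.pow_right {c : F} {a b : B} (h : Skew c a b) (n : ℕ) : Skew (c ^ n) a (b ^ n) := by
  induction n with
  | zero => simpa using skew_one_right a
  | succ n ih => rw [pow_succ, pow_succ]; exact ih.mul_right h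

theorem Skew.smul_right {c : F} {a b : B} (h : Skew c a b) (r : F) : Skew c a (r • b) := by
  rw [Skew] at *
  rw [mul_smul_comm, h, smul_mul_assoc, smul_comm]

theorem Skew.add_right {c : F} {a b b' : B} (h : Skew c a b) (h' : Skew c a b') :
    Skew c a (b + b') := by
  rw [Skew] at *
  rw [mul_add, add_mul, h, h', smul_add]

theorem Skew.inv_right {c : F} (hc : c ≠ 0) {a : B} {k : Bˣ} (h : Skew c a (k : B)) :
    Skew c⁻¹ a (↑k⁻¹ : B) := by
  rw [Skew] at *
  have h1 : (k : B) * (a * ↑k⁻¹) = c⁻¹ • a := by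
    rw [← mul_assoc, ← inv_smul_smul₀ hc ((k : B) * a), ← h, smul_mul_assoc, mul_assoc,
      Units.mul_inv, mul_one]
  rw [← mul_smul_comm, ← h1, ← mul_assoc, Units.inv_mul, one_mul]

theorem Skew.zpow_right {c : F} (hc : c ≠ 0) {a : B} {k : Bˣ} (h : Skew c a (k : B)) (n : ℤ) :
    Skew (c ^ n) a (↑(k ^ n) : B) := by
  cases n with
  | ofNat n => simpa using h.pow_right n
  | negSucc n =>
    have := (h.inv_right hc).pow_right (n + 1)
    rw [zpow_negSucc, zpow_negSucc, ← inv_pow, ← inv_pow]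
    simpa using this

theorem Skew.map {C : Type w} [Ring C] [Algebra F C] (f : B →ₐ[F] C) {c : F} {a b : B}
    (h : Skew c a b) : Skew c (f a) (f b) := by
  rw [Skew] at *
  rw [← map_mul, h, map_smul, map_mul]

variable (F) in
/-- The span of the elements that commute up to scalars with every element of `U`, the scalar
being different from `1` for at least one of them. -/
def nontrivialWeights (U : Set B) : Submodule F B :=
  Submodule.span F {v | (∀ a ∈ U, ∃ c : F, Skew c a v) ∧ ∃ a ∈ U, ∃ c : F, c ≠ 1 ∧ Skew c a v}

theorem smul_mem_ideal (I : TwoSidedIdeal B) (c : F) {x : B} (hx : x ∈ I) : c • x ∈ I := by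
  rw [Algebra.smul_def]; exact I.mul_mem_left _ _ hx

/-- Induction on the number of summands. With `a` the unit `k` of weight `c ≠ 1` on `f j`, the
element `k * x - c • (x * k)` of `I` loses `f j`, while `b` is multiplied by `1 - c ≠ 0` and `f i`
by `d i - c`. Dividing by `1 - c` and by `k` restores the shape. Rescaled summands may vanish, which
is harmless since `0` has every weight. -/
theorem mem_of_add_sum_mem {ι : Type w} (I : TwoSidedIdeal B) {U : Set B}
    (hU : ∀ a ∈ U, IsUnit a) {b : B} (hb : ∀ a ∈ U, Commute a b) (s : Finset ι) :
    ∀ f : ι → B, (∀ i ∈ s, (∀ a ∈ U, ∃ c : F, Skew c a (f i)) ∧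
      ∃ a ∈ U, ∃ c : F, c ≠ 1 ∧ Skew c a (f i)) → b + ∑ i ∈ s, f i ∈ I → b ∈ I := by
  classical
  induction s using Finset.induction_on with
  | empty => intro f _ h; simpa using h
  | insert j s hj ih =>
    intro f hf h
    obtain ⟨-, a, ha, c, hc, hac⟩ := hf j (Finset.mem_insert_self j s)
    have hs := fun i (hi : i ∈ s) => hf i (Finset.mem_insert_of_mem hi)
    have hd : ∀ i, ∃ d : F, i ∈ s → Skew d a (f i) := fun i => by
      by_cases hi : i ∈ s
      · obtain ⟨d, hd⟩ := (hs i hi).1 a ha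
        exact ⟨d, fun _ => hd⟩
      · exact ⟨0, fun h => absurd h hi⟩
    choose d hd using hd
    have hc' : 1 - c ≠ 0 := sub_ne_zero.2 hc.symm
    refine ih (fun i => ((1 - c)⁻¹ * (d i - c)) • f i) (fun i hi => ?_) ?_
    · obtain ⟨h1, a', ha', c', hc1, hac'⟩ := hs i hi
      refine ⟨fun u hu => ?_, a', ha', c', hc1, hac'.smul_right _⟩
      obtain ⟨r, hr⟩ := h1 u hu
      exact ⟨r, hr.smul_right _⟩
    · rw [Finset.sum_insert hj] at h
      set x := b + (f j + ∑ i ∈ s, f i) with hx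
      obtain ⟨k, rfl⟩ := hU a ha
      have h1 : (k : B) * x - c • (x * k) ∈ I :=
        I.sub_mem (I.mul_mem_left _ _ h) (smul_mem_ideal I c (I.mul_mem_right _ _ h))
      have h2 : (k : B) * x - c • (x * k) =
          ((1 - c) • b + ∑ i ∈ s, (d i - c) • f i) * k := by
        have e1 : (k : B) * ∑ i ∈ s, f i = ∑ i ∈ s, d i • (f i * k) := by
          rw [Finset.mul_sum]
          exact Finset.sum_congr rfl fun i hi => hd i hi
        have e2 : (∑ i ∈ s, (d i - c) • f i) * (k : B) =
            ∑ i ∈ s, d i • (f i * k) - c • ((∑ i ∈ s, f i) * (k : B)) := by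
          rw [Finset.sum_mul, Finset.sum_mul, Finset.smul_sum, ← Finset.sum_sub_distrib]
          exact Finset.sum_congr rfl fun i _ => by rw [smul_mul_assoc, sub_smul]
        rw [hx, mul_add, mul_add, hac, e1, (hb _ ha).eq, add_mul, add_mul, add_mul, e2, sub_smul,
          one_smul, sub_mul, smul_mul_assoc, smul_add, smul_add]
        abel
      have h3 := smul_mem_ideal I (1 - c)⁻¹ (I.mul_mem_right _ (↑k⁻¹ : B) h1)
      rw [h2, mul_assoc, Units.mul_inv, mul_one, smul_add, inv_smul_smul₀ hc', Finset.smul_sum] at h3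
      simpa only [smul_smul] using h3

theorem mem_of_add_mem (I : TwoSidedIdeal B) {U : Set B} (hU : ∀ a ∈ U, IsUnit a) {b v : B}
    (hb : ∀ a ∈ U, Commute a b) (hv : v ∈ nontrivialWeights F U) (h : b + v ∈ I) : b ∈ I := by
  obtain ⟨n, r, g, rfl⟩ := Submodule.mem_span_set'.1 hv
  refine mem_of_add_sum_mem (F := F) I hU hb Finset.univ _ (fun i _ => ?_) h
  obtain ⟨h1, a, ha, c, hc, hac⟩ := (g i).2
  refine ⟨fun u hu => ?_, a, ha, c, hc, hac.smul_right _⟩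
  obtain ⟨d, hd⟩ := h1 u hu
  exact ⟨d, hd.smul_right _⟩

theorem span_closure_eq_top {s : Set B} (hs : Algebra.adjoin F s = ⊤) :
    Submodule.span F (Submonoid.closure s : Set B) = ⊤ := by
  rw [← Algebra.adjoin_eq_span, hs, Algebra.top_toSubmodule]

/-- An element that commutes up to nonzero scalars with a generating set is normal. -/
theorem exists_mul_eq_mul {s : Set B} (hs : Algebra.adjoin F s = ⊤) {n : B}
    (h : ∀ g ∈ s, ∃ c : F, c ≠ 0 ∧ Skew c n g) (b : B) :
    (∃ b', n * b = b' * n) ∧ ∃ b', b * n = n * b' := by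
  have hb : b ∈ Algebra.adjoin F s := hs ▸ Algebra.mem_top
  induction hb using Algebra.adjoin_induction with
  | mem x hx =>
    obtain ⟨c, hc, hx⟩ := h x hx
    refine ⟨⟨c • x, by rw [hx, smul_mul_assoc]⟩, ⟨c⁻¹ • x, ?_⟩⟩
    rw [mul_smul_comm]; exact hx.symm hc
  | algebraMap r =>
    exact ⟨⟨_, (Algebra.commutes r n).symm⟩, ⟨_, Algebra.commutes r n⟩⟩
  | add x y _ _ hx hy =>
    obtain ⟨⟨a, ha⟩, ⟨a', ha'⟩⟩ := hx
    obtain ⟨⟨b, hb⟩, ⟨b', hb'⟩⟩ := hy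
    exact ⟨⟨a + b, by rw [mul_add, add_mul, ha, hb]⟩, ⟨a' + b', by rw [mul_add, add_mul, ha', hb']⟩⟩
  | mul x y _ _ hx hy =>
    obtain ⟨⟨a, ha⟩, ⟨a', ha'⟩⟩ := hx
    obtain ⟨⟨b, hb⟩, ⟨b', hb'⟩⟩ := hy
    exact ⟨⟨a * b, by rw [← mul_assoc, ha, mul_assoc, hb, mul_assoc]⟩,
      ⟨a' * b', by rw [mul_assoc, hb', ← mul_assoc, ha', mul_assoc]⟩⟩

/-- By normality the right ideal `n * B` is two-sided, so it contains `1`; normality again turns the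
right inverse into a left one. -/
theorem isUnit_of_skew [IsSimpleRing B] {s : Set B} (hs : Algebra.adjoin F s = ⊤) {n : B}
    (h : ∀ g ∈ s, ∃ c : F, c ≠ 0 ∧ Skew c n g) (hn : n ≠ 0) : IsUnit n := by
  let I : TwoSidedIdeal B := TwoSidedIdeal.mk' {x | ∃ b, x = n * b} ⟨0, by simp⟩
    (by rintro _ _ ⟨a, rfl⟩ ⟨b, rfl⟩; exact ⟨a + b, by rw [mul_add]⟩)
    (by rintro _ ⟨a, rfl⟩; exact ⟨-a, by rw [mul_neg]⟩)
    (by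
      rintro x _ ⟨a, rfl⟩
      obtain ⟨b, hb⟩ := (exists_mul_eq_mul hs h x).2
      exact ⟨b * a, by rw [← mul_assoc, hb, mul_assoc]⟩)
    (by rintro _ y ⟨a, rfl⟩; exact ⟨a * y, by rw [mul_assoc]⟩)
  have hmem : ∀ x, x ∈ I ↔ ∃ b, x = n * b := fun x => TwoSidedIdeal.mem_mk' _ _ _ _ _ _ _
  have hI : (1 : B) ∈ I := by
    rw [TwoSidedIdeal.one_mem_iff]
    refine (eq_bot_or_eq_top I).resolve_left fun h0 => hn ?_
    have : n ∈ I := (hmem n).2 ⟨1, by simp⟩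
    rw [h0] at this
    exact (TwoSidedIdeal.mem_bot B).1 this
  obtain ⟨b, hb⟩ := (hmem 1).1 hI
  obtain ⟨b', hb'⟩ := (exists_mul_eq_mul hs h b).1
  exact isUnit_iff_exists_and_exists.2 ⟨⟨b, hb.symm⟩, b', hb' ▸ hb.symm⟩

theorem isUnit_of_central (F : Type u) [Field F] {B : Type v} [Ring B] [Algebra F B]
    [IsSimpleRing B] {n : B} (h : ∀ b, Commute n b) (hn : n ≠ 0) :
    IsUnit n :=
  isUnit_of_skew (F := F) (Algebra.adjoin_univ F B)
    (fun g _ => ⟨1, one_ne_zero, skew_one_iff.2 (h g)⟩) hn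

/-- If `n` were nonzero it would be a unit, and `-1 = n * (-n⁻¹)` would be a sum of vectors of
nontrivial weight. Eliminating them from `1 + (-1) = 0` leaves `1 = 0`. -/
theorem eq_zero_of_mul_mem_nontrivialWeights [IsSimpleRing B] {s : Set B}
    (hs : Algebra.adjoin F s = ⊤) {n : B} (h : ∀ g ∈ s, ∃ c : F, c ≠ 0 ∧ Skew c n g) {U : Set B}
    (hU : n ≠ 0 → ∀ a ∈ U, IsUnit a)
    (hw : ∀ b ∈ Submonoid.closure s, n * b ∈ nontrivialWeights F U) : n = 0 := by
  by_contra hn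
  obtain ⟨k, rfl⟩ := isUnit_of_skew hs h hn
  have hall : ∀ b, (k : B) * b ∈ nontrivialWeights F U := fun b => by
    have hb : b ∈ Submodule.span F (Submonoid.closure s : Set B) := by
      rw [span_closure_eq_top hs]; trivial
    induction hb using Submodule.span_induction with
    | mem x hx => exact hw x hx
    | zero => simp
    | add x y _ _ hx hy => rw [mul_add]; exact add_mem hx hy
    | smul r x _ hx => rw [mul_smul_comm]; exact Submodule.smul_mem _ _ hx
  have h1 : (1 : B) ∈ (⊥ : TwoSidedIdeal B) := by
    refine mem_of_add_mem (F := F) _ (hU hn) (fun a _ => Commute.one_right a) (hall (-↑k⁻¹)) ?_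
    rw [mul_neg, Units.mul_inv, add_neg_cancel]
    exact TwoSidedIdeal.zero_mem _
  exact one_ne_zero ((TwoSidedIdeal.mem_bot B).1 h1)

end Skew

end QuantumAgeing

/-! ### The common structure of the two factor algebras. -/

namespace QuantumAgeing

universe u v w

variable {F : Type u} [Field F] {B : Type v} [Ring B] [Algebra F B]

/-- A unit `k` and two elements `y`, `e` generating an algebra, which commute with each other up
to powers of `p`, together with a central element `z` proportional to `y² e k`. Both factor
algebras of the quantum spatial ageing algebra are of this kind. -/
structure QuantumTriple (p c : F) (k : Bˣ) (y e z : B) : Prop where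
  ne_zero : p ≠ 0
  zpow_eq_one : ∀ n : ℤ, p ^ n = 1 → n = 0
  coeff_ne_zero : c ≠ 0
  skew_y_k : Skew p y (k : B)
  skew_e_k : Skew (p⁻¹ ^ 2) e (k : B)
  skew_e_y : Skew p e y
  z_eq : z = c • (y * y * e * k)
  adjoin_eq_top : Algebra.adjoin F {(k : B), (↑k⁻¹ : B), y, e} = ⊤

namespace QuantumTriple

variable {p c : F} {k : Bˣ} {y e z : B}

theorem map {C : Type w} [Ring C] [Algebra F C] (h : QuantumTriple p c k y e z) (f : B →ₐ[F] C)
    (hf : Function.Surjective f) :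
    QuantumTriple p c (Units.map (f : B →* C) k) (f y) (f e) (f z) where
  ne_zero := h.ne_zero
  zpow_eq_one := h.zpow_eq_one
  coeff_ne_zero := h.coeff_ne_zero
  skew_y_k := h.skew_y_k.map f
  skew_e_k := h.skew_e_k.map f
  skew_e_y := h.skew_e_y.map f
  z_eq := by rw [h.z_eq]; simp
  adjoin_eq_top := by
    have := congrArg (Subalgebra.map f) h.adjoin_eq_top
    rw [AlgHom.map_adjoin, Algebra.map_top, (AlgHom.range_eq_top f).2 hf] at this
    rw [← this]
    simp [Set.image_insert_eq]

theorem skew_k_y (h : QuantumTriple p c k y e z) : Skew p⁻¹ (k : B) y := h.skew_y_k.symm h.ne_zero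

theorem skew_k_e (h : QuantumTriple p c k y e z) : Skew (p ^ 2) (k : B) e := by
  simpa using h.skew_e_k.symm (pow_ne_zero 2 (inv_ne_zero h.ne_zero))

theorem skew_y_e (h : QuantumTriple p c k y e z) : Skew p⁻¹ y e := h.skew_e_y.symm h.ne_zero

/-- Against each of `k`, `y`, `e` the scalars picked up from the factors of `y * y * e * k` multiply
to `1`. -/
theorem commute_z (h : QuantumTriple p c k y e z) (b : B) : Commute z b := by
  have hp := h.ne_zero
  have hk : Commute (k : B) z := by
    have := (((h.skew_k_y.mul_right h.skew_k_y).mul_right h.skew_k_e).mul_right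
      (Skew.refl (k : B))).smul_right c
    rw [← h.z_eq, show p⁻¹ * p⁻¹ * p ^ 2 * 1 = 1 by field_simp] at this
    exact skew_one_iff.1 this
  have hy : Commute y z := by
    have := ((((Skew.refl y).mul_right (Skew.refl y)).mul_right h.skew_y_e).mul_right
      h.skew_y_k).smul_right c
    rw [← h.z_eq, show 1 * 1 * p⁻¹ * p = 1 by field_simp] at this
    exact skew_one_iff.1 this
  have he : Commute e z := by
    have := (((h.skew_e_y.mul_right h.skew_e_y).mul_right (Skew.refl e)).mul_right
      h.skew_e_k).smul_right c
    rw [← h.z_eq, show p * p * 1 * p⁻¹ ^ 2 = 1 by field_simp] at this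
    exact skew_one_iff.1 this
  refine Algebra.commute_of_mem_adjoin_of_forall_mem_commute (R := F)
    (h.adjoin_eq_top ▸ Algebra.mem_top : b ∈ Algebra.adjoin F {(k : B), (↑k⁻¹ : B), y, e}) ?_
  rintro _ (rfl | rfl | rfl | rfl)
  exacts [hk.symm, hk.symm.units_inv_right, hy.symm, he.symm]

theorem commute_of_mem_adjoin (h : QuantumTriple p c k y e z) {l : B}
    (hl : l ∈ Algebra.adjoin F {z}) (b : B) : Commute l b := by
  refine (Algebra.commute_of_mem_adjoin_of_forall_mem_commute hl ?_).symm
  rintro _ rfl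
  exact (h.commute_z b).symm

/-- Only spanning by ordered monomials is claimed; their linear independence plays no role. -/
theorem exists_normal_form (h : QuantumTriple p c k y e z) {v : B}
    (hv : v ∈ Submonoid.closure {(k : B), (↑k⁻¹ : B), y, e}) :
    ∃ (r : F) (i : ℤ) (m n : ℕ), v = r • ((↑(k ^ i) : B) * y ^ m * e ^ n) := by
  induction hv using Submonoid.closure_induction_left with
  | one => exact ⟨1, 0, 0, 0, by simp⟩
  | mul_left x hx v _ ih =>
    obtain ⟨r, i, m, n, rfl⟩ := ih
    obtain rfl | rfl | rfl | rfl := hx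
    · refine ⟨r, 1 + i, m, n, ?_⟩
      rw [zpow_add, zpow_one, mul_smul_comm, Units.val_mul]
      simp only [mul_assoc]
    · refine ⟨r, -1 + i, m, n, ?_⟩
      rw [zpow_add, zpow_neg_one, mul_smul_comm, Units.val_mul]
      simp only [mul_assoc]
    · refine ⟨r * p ^ i, i, m + 1, n, ?_⟩
      have := h.skew_y_k.zpow_right h.ne_zero i
      rw [Skew] at this
      rw [mul_smul_comm, ← mul_assoc, ← mul_assoc, this, pow_succ', mul_smul]
      simp only [smul_mul_assoc, mul_assoc]
    · refine ⟨r * ((p⁻¹ ^ 2) ^ i * p ^ m), i, m, n + 1, ?_⟩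
      have := (h.skew_e_k.zpow_right (pow_ne_zero 2 (inv_ne_zero h.ne_zero)) i).mul_right
        (h.skew_e_y.pow_right m)
      rw [Skew] at this
      rw [mul_smul_comm, ← mul_assoc, this, pow_succ' x n, smul_mul_assoc, smul_smul]
      simp only [mul_assoc]

/-- These monomials are scalar multiples of `z ^ n`: pulling out one factor `y * y * e * k` at a
time costs only a scalar. -/
theorem degree_zero_mem_adjoin (h : QuantumTriple p c k y e z) (n : ℕ) :
    (↑(k ^ (n : ℤ)) : B) * y ^ (2 * n) * e ^ n ∈ Algebra.adjoin F {z} := by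
  induction n with
  | zero => simp
  | succ n ih =>
    have hp := h.ne_zero
    have hs : ∃ r : F, r ≠ 0 ∧ Skew r (k : B) (y ^ (2 * n) * (y * y * e)) :=
      ⟨_, ?_, (h.skew_k_y.pow_right (2 * n)).mul_right
        ((h.skew_k_y.mul_right h.skew_k_y).mul_right h.skew_k_e)⟩
    · obtain ⟨r, hr, hs⟩ := hs
      have key : (↑(k ^ ((n + 1 : ℕ) : ℤ)) : B) * y ^ (2 * (n + 1)) * e ^ (n + 1) =
          (r * c⁻¹) • (z * ((↑(k ^ (n : ℤ)) : B) * y ^ (2 * n) * e ^ n)) := by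
        have e1 : z * ((↑(k ^ (n : ℤ)) : B) * y ^ (2 * n) * e ^ n) =
            (↑(k ^ (n : ℤ)) : B) * y ^ (2 * n) * z * e ^ n := by
          rw [← mul_assoc, (h.commute_z _).eq]
        have e2 : (↑(k ^ ((n + 1 : ℕ) : ℤ)) : B) * y ^ (2 * (n + 1)) * e ^ (n + 1) =
            (↑(k ^ (n : ℤ)) : B) * ((k : B) * (y ^ (2 * n) * (y * y * e))) * e ^ n := by
          rw [Nat.cast_succ, zpow_add_one, Units.val_mul, pow_succ' e, mul_add, pow_add]
          simp only [mul_assoc, pow_two, mul_one]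
        rw [e1, e2, hs, h.z_eq]
        simp only [mul_smul_comm, smul_mul_assoc, smul_smul, mul_assoc]
        rw [inv_mul_cancel₀ h.coeff_ne_zero, mul_one]
      rw [key]
      exact Subalgebra.smul_mem _ (mul_mem (Algebra.self_mem_adjoin_singleton F z) ih) _
    · have := inv_ne_zero hp
      positivity

/-- The monomial `k ^ i * y ^ m * e ^ n` has weight `p ^ (2n - m)` under `k` and `p ^ (i - n)` under
`y`. Both are trivial exactly when `i = n` and `m = 2n`, which are the monomials lying in `F[z]`. -/
theorem mem_adjoin_sup_nontrivialWeights (h : QuantumTriple p c k y e z) (b : B) :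
    b ∈ Subalgebra.toSubmodule (Algebra.adjoin F {z}) ⊔ nontrivialWeights F {(k : B), y} := by
  have hp := h.ne_zero
  have hb : b ∈ Submodule.span F
      (Submonoid.closure {(k : B), (↑k⁻¹ : B), y, e} : Set B) := by
    rw [span_closure_eq_top h.adjoin_eq_top]; trivial
  refine (?_ : Submodule.span F _ ≤ _) hb
  rw [Submodule.span_le]
  intro v hv
  obtain ⟨r, i, m, n, rfl⟩ := h.exists_normal_form hv
  refine Submodule.smul_mem _ _ ?_
  have hk := (((Skew.refl (F := F) (k : B)).zpow_right one_ne_zero i).mul_right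
    (h.skew_k_y.pow_right m)).mul_right (h.skew_k_e.pow_right n)
  have hy := ((h.skew_y_k.zpow_right hp i).mul_right ((Skew.refl y).pow_right m)).mul_right
    (h.skew_y_e.pow_right n)
  rw [show (1 : F) ^ i * p⁻¹ ^ m * (p ^ 2) ^ n = p ^ (2 * (n : ℤ) - m) by
    rw [zpow_sub₀ hp, zpow_mul]; simp [div_eq_mul_inv, mul_comm]] at hk
  rw [show p ^ i * 1 ^ m * p⁻¹ ^ n = p ^ (i - (n : ℤ)) by
    rw [zpow_sub₀ hp]; simp [div_eq_mul_inv]] at hy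
  by_cases h0 : i = n ∧ m = 2 * n
  · obtain ⟨rfl, rfl⟩ := h0
    exact Submodule.mem_sup_left (h.degree_zero_mem_adjoin n)
  · refine Submodule.mem_sup_right (Submodule.subset_span ⟨?_, ?_⟩)
    · rintro _ (rfl | rfl)
      exacts [⟨_, hk⟩, ⟨_, hy⟩]
    · by_cases hi : i = n
      · refine ⟨k, Or.inl rfl, _, fun h1 => h0 ⟨hi, ?_⟩, hk⟩
        have := h.zpow_eq_one _ h1
        omega
      · refine ⟨y, Or.inr rfl, _, fun h1 => hi ?_, hy⟩
        have := h.zpow_eq_one _ h1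
        omega

/-- In a simple quotient, the nonzero elements of the algebra generated by `z` are invertible in
that algebra. -/
theorem exists_mul_eq_one [IsSimpleRing B] (h : QuantumTriple p c k y e z) (hy : IsUnit y) {l : B}
    (hl : l ∈ Algebra.adjoin F {z}) (hl0 : l ≠ 0) : ∃ l' ∈ Algebra.adjoin F {z}, l' * l = 1 := by
  obtain ⟨x, rfl⟩ := isUnit_of_central F (h.commute_of_mem_adjoin hl) hl0
  -- The inverse of `x` splits as `l' + v` with `v` of nontrivial weights. As `x` is central, `v *
  -- x` has the same weights as `v`, so eliminating it from `(l' * x - 1) + v * x = 0` shows that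
  -- `l'` is already the inverse.
  obtain ⟨l', hl', v, hv, hx⟩ := Submodule.mem_sup.1 (h.mem_adjoin_sup_nontrivialWeights ↑x⁻¹)
  refine ⟨l', hl', ?_⟩
  have hxv : v * x ∈ nontrivialWeights F {(k : B), y} := by
    have hle : nontrivialWeights F {(k : B), y} ≤ (nontrivialWeights F {(k : B), y}).comap
        (LinearMap.mulRight F (x : B)) := by
      refine Submodule.span_le.2 ?_
      rintro w ⟨hw, a, ha, d, hd, hw'⟩
      have hc : ∀ a : B, Skew (1 : F) a x := fun a =>
        skew_one_iff.2 (h.commute_of_mem_adjoin hl a).symm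
      refine Submodule.subset_span ⟨fun a ha => ?_, a, ha, d, hd, ?_⟩
      · obtain ⟨d, hd⟩ := hw a ha
        exact ⟨_, hd.mul_right (hc a)⟩
      · simpa using hw'.mul_right (hc a)
    exact hle hv
  have hz : l' * x - 1 ∈ (⊥ : TwoSidedIdeal B) := by
    refine mem_of_add_mem (F := F) _ (U := {(k : B), y}) ?_ ?_ hxv ?_
    · rintro _ (rfl | rfl)
      exacts [k.isUnit, hy]
    · exact fun a _ => (((h.commute_of_mem_adjoin (mul_mem hl' hl) a).symm).sub_right
        (Commute.one_right a))
    · have : l' * x - 1 + v * x = 0 := by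
        rw [sub_add_eq_add_sub, ← add_mul]
        erw [hx]
        rw [Units.inv_mul, sub_self]
      rw [this]; exact TwoSidedIdeal.zero_mem _
  exact sub_eq_zero.1 ((TwoSidedIdeal.mem_bot B).1 hz)

theorem isUnit_y (h : QuantumTriple p c k y e z) (hz : IsUnit z) : IsUnit y := by
  obtain ⟨x, rfl⟩ := hz
  have hr : y * (c • (y * e * k) * ↑x⁻¹) = 1 := by
    have : y * (c • (y * e * k)) = x := by
      rw [h.z_eq, mul_smul_comm]; simp only [mul_assoc]
    rw [← mul_assoc, this, Units.mul_inv]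
  have hl : (↑x⁻¹ * c • (y * e * k)) * y = 1 := by
    -- For the left inverse: `y` commutes with `y * e * k`, so `z` also has `y` as its last factor.
    have h1 := ((Skew.refl (F := F) y).mul_right h.skew_y_e).mul_right h.skew_y_k
    rw [one_mul, inv_mul_cancel₀ h.ne_zero, skew_one_iff] at h1
    have : (c • (y * e * k)) * y = x := by
      rw [h.z_eq, smul_mul_assoc, ← h1.eq]; simp only [mul_assoc]
    rw [mul_assoc, this, Units.inv_mul]
  exact isUnit_iff_exists_and_exists.2 ⟨⟨_, hr⟩, _, hl⟩

theorem eq_of_unit (h : QuantumTriple p c k y e z) {x : Bˣ} (hx : (x : B) = y) :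
    e = c⁻¹ • ((↑x⁻¹ : B) * ↑x⁻¹ * z * ↑k⁻¹) := by
  subst hx
  rw [h.z_eq, mul_smul_comm, smul_mul_assoc, inv_smul_smul₀ h.coeff_ne_zero]
  simp [mul_assoc]

/-- Once `y` is invertible, `e` is a multiple of `y⁻² z k⁻¹`, so the `F[z]`-span of the `k ^ i * y ^
j` with integer exponents is stable under left multiplication by every generator. -/
theorem mem_iSup_of_unit (h : QuantumTriple p c k y e z) {x : Bˣ} (hx : (x : B) = y) (b : B) :
    b ∈ ⨆ i : ℤ × ℤ, (Subalgebra.toSubmodule (Algebra.adjoin F {z})).map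
      (LinearMap.mulRight F ((↑(k ^ i.1) : B) * ↑(x ^ i.2))) := by
  have hp := h.ne_zero
  set V : ℤ × ℤ → Submodule F B := fun i => (Subalgebra.toSubmodule (Algebra.adjoin F {z})).map
      (LinearMap.mulRight F ((↑(k ^ i.1) : B) * ↑(x ^ i.2))) with hV
  have hmem : ∀ {l : B}, l ∈ Algebra.adjoin F {z} → ∀ i j : ℤ,
      l * (↑(k ^ i) * ↑(x ^ j)) ∈ ⨆ i, V i := fun {l} hl i j =>
    Submodule.mem_iSup_of_mem (i, j) ⟨l, hl, rfl⟩
  have hone : (1 : B) ∈ ⨆ i, V i := by simpa using hmem (one_mem _) 0 0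
  have hkl : ∀ i : ℤ, ∀ v ∈ ⨆ i, V i, (↑(k ^ i) : B) * v ∈ ⨆ i, V i := fun n v hv => by
    refine Submodule.iSup_induction V (motive := fun v => (↑(k ^ n) : B) * v ∈ ⨆ i, V i) hv ?_ ?_ ?_
    · rintro ⟨i, j⟩ _ ⟨l, hl, rfl⟩
      have := hmem hl (n + i) j
      rw [zpow_add, Units.val_mul] at this
      simpa only [LinearMap.mulRight_apply, ← mul_assoc, (h.commute_of_mem_adjoin hl _).eq]
        using this
    · simp
    · intro a b ha hb; rw [mul_add]; exact add_mem ha hb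
  have hyl : ∀ j : ℤ, ∀ v ∈ ⨆ i, V i, (↑(x ^ j) : B) * v ∈ ⨆ i, V i := fun n v hv => by
    refine Submodule.iSup_induction V (motive := fun v => (↑(x ^ n) : B) * v ∈ ⨆ i, V i) hv ?_ ?_ ?_
    · rintro ⟨i, j⟩ _ ⟨l, hl, rfl⟩
      have hk : Skew p⁻¹ (k : B) x := hx ▸ h.skew_k_y
      have h1 := ((hk.zpow_right (inv_ne_zero hp) n).symm
        (zpow_ne_zero _ (inv_ne_zero hp))).zpow_right
          (inv_ne_zero (zpow_ne_zero _ (inv_ne_zero hp))) i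
      have := Submodule.smul_mem _ (((p⁻¹ ^ n)⁻¹) ^ i) (hmem hl i (n + j))
      rw [zpow_add, Units.val_mul, ← mul_assoc (↑(k ^ i) : B), ← mul_smul_comm,
        ← smul_mul_assoc, ← h1] at this
      rw [LinearMap.mulRight_apply, ← mul_assoc, ← (h.commute_of_mem_adjoin hl _).eq]
      simpa only [mul_assoc] using this
    · simp
    · intro a b ha hb; rw [mul_add]; exact add_mem ha hb
  have hzl : ∀ v ∈ ⨆ i, V i, z * v ∈ ⨆ i, V i := fun v hv => by
    refine Submodule.iSup_induction V (motive := fun v => z * v ∈ ⨆ i, V i) hv ?_ ?_ ?_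
    · rintro ⟨i, j⟩ _ ⟨l, hl, rfl⟩
      rw [LinearMap.mulRight_apply, ← mul_assoc]
      exact hmem (mul_mem (Algebra.self_mem_adjoin_singleton F z) hl) i j
    · simp
    · intro a b ha hb; rw [mul_add]; exact add_mem ha hb
  have hb : b ∈ Submodule.span F
      (Submonoid.closure {(k : B), (↑k⁻¹ : B), y, e} : Set B) := by
    rw [span_closure_eq_top h.adjoin_eq_top]; trivial
  refine (?_ : Submodule.span F _ ≤ _) hb
  rw [Submodule.span_le]
  intro v hv
  induction hv using Submonoid.closure_induction_left with
  | one => exact hone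
  | mul_left g hg v _ ih =>
    obtain rfl | rfl | rfl | rfl := hg
    · simpa using hkl 1 v ih
    · simpa using hkl (-1) v ih
    · simpa [hx] using hyl 1 v ih
    · rw [h.eq_of_unit hx, smul_mul_assoc]
      have := hyl (-1) _ (hyl (-1) _ (hzl _ (hkl (-1) v ih)))
      simp only [zpow_neg_one] at this
      replace this := Submodule.smul_mem _ c⁻¹ this
      simp only [mul_assoc] at this ⊢
      exact this

/-- The quantum torus argument over the field `F[z]`: normalise one nonzero term of an element of
`I` to `1`. The remaining terms then have weights `p ^ (j₀ - j)` under `k` and `p ^ (i - i₀)` under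
`y`, not both trivial, and can be eliminated. -/
theorem isSimpleRing [Nontrivial B] (h : QuantumTriple p c k y e z) (hz : z ≠ 0)
    (hl : ∀ l ∈ Algebra.adjoin F {z}, l ≠ 0 → ∃ l' ∈ Algebra.adjoin F {z}, l' * l = 1) :
    IsSimpleRing B := by
  have hp := h.ne_zero
  have hzu : IsUnit z := by
    obtain ⟨l', hl', h1⟩ := hl z (Algebra.self_mem_adjoin_singleton F z) hz
    exact isUnit_iff_exists_and_exists.2 ⟨⟨l', (h.commute_z l').eq ▸ h1⟩, l', h1⟩
  obtain ⟨x, hx⟩ := h.isUnit_y hzu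
  refine isSimpleRing_of_one_mem fun I b hb hb0 => ?_
  obtain ⟨f, hf, hfb⟩ := (Submodule.mem_iSup_iff_exists_finsupp _ _).1 (h.mem_iSup_of_unit hx b)
  obtain ⟨i₀, hi₀⟩ : ∃ i, i ∈ f.support := by
    by_contra! hne
    refine hb0 ?_
    rw [← hfb, Finsupp.sum, Finset.sum_eq_zero]
    exact fun i hi => absurd hi (hne i)
  choose l hlm hlf using hf
  have hl0 : l i₀ ≠ 0 := by
    intro h0
    refine (Finsupp.mem_support_iff.1 hi₀) ?_
    rw [← hlf i₀, h0, map_zero]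
  obtain ⟨l', hl', hl1⟩ := hl _ (hlm i₀) hl0
  set t : B := ↑(x ^ (-i₀.2)) * ↑(k ^ (-i₀.1)) with ht
  have hsum : l' * b * t = 1 + ∑ i ∈ f.support.erase i₀, l' * f i * t := by
    rw [← hfb, Finsupp.sum, Finset.mul_sum, Finset.sum_mul, ← Finset.add_sum_erase _ _ hi₀]
    congr 1
    rw [← hlf i₀, LinearMap.mulRight_apply, ← mul_assoc l', hl1, one_mul, ht, mul_assoc,
      ← mul_assoc (↑(x ^ i₀.2) : B), ← Units.val_mul, ← zpow_add, add_neg_cancel, zpow_zero,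
      Units.val_one, one_mul, ← Units.val_mul, ← zpow_add, add_neg_cancel, zpow_zero, Units.val_one]
  refine mem_of_add_mem (F := F) I (U := {(k : B), y}) (b := 1)
    (v := ∑ i ∈ f.support.erase i₀, l' * f i * t) ?_ (fun a _ => Commute.one_right a) ?_ ?_
  · rintro _ (rfl | rfl)
    exacts [k.isUnit, hx ▸ x.isUnit]
  · refine Submodule.sum_mem _ fun i hi => Submodule.subset_span ?_
    have hL : ∀ a : B, Skew (1 : F) a (l' * l i) := fun a =>
      skew_one_iff.2 (h.commute_of_mem_adjoin (mul_mem hl' (hlm i)) a).symm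
    have hkx : Skew p⁻¹ (k : B) x := hx ▸ h.skew_k_y
    have hyx : Skew (1 : F) y x := by rw [hx]; exact Skew.refl y
    have hk1 : Skew (1 : F) (k : B) k := Skew.refl _
    have hp' := inv_ne_zero hp
    have hk := ((hL k).mul_right ((hk1.zpow_right one_ne_zero i.1).mul_right
      (hkx.zpow_right hp' i.2))).mul_right ((hkx.zpow_right hp' (-i₀.2)).mul_right
        (hk1.zpow_right one_ne_zero (-i₀.1)))
    have hy := ((hL y).mul_right ((h.skew_y_k.zpow_right hp i.1).mul_right
      (hyx.zpow_right one_ne_zero i.2))).mul_right ((hyx.zpow_right one_ne_zero (-i₀.2)).mul_right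
        (h.skew_y_k.zpow_right hp (-i₀.1)))
    have hfi : l' * f i * t = l' * l i * (↑(k ^ i.1) * ↑(x ^ i.2)) * t := by
      rw [← hlf i, LinearMap.mulRight_apply]; simp only [mul_assoc]
    rw [← ht, ← hfi] at hk hy
    rw [show (1 : F) * ((1 : F) ^ i.1 * p⁻¹ ^ i.2) * (p⁻¹ ^ (-i₀.2) * 1 ^ (-i₀.1)) =
      p ^ (i₀.2 - i.2) by rw [zpow_sub₀ hp]; simp [div_eq_mul_inv, mul_comm]] at hk
    rw [show (1 : F) * (p ^ i.1 * (1 : F) ^ i.2) * (1 ^ (-i₀.2) * p ^ (-i₀.1)) =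
      p ^ (i.1 - i₀.1) by rw [zpow_sub₀ hp]; simp [div_eq_mul_inv]] at hy
    refine ⟨?_, ?_⟩
    · rintro _ (rfl | rfl)
      exacts [⟨_, hk⟩, ⟨_, hy⟩]
    · by_cases hi1 : i.1 = i₀.1
      · refine ⟨k, Or.inl rfl, _, fun h1 => (Finset.mem_erase.1 hi).1 (Prod.ext hi1 ?_), hk⟩
        have := h.zpow_eq_one _ h1
        omega
      · refine ⟨y, Or.inr rfl, _, fun h1 => hi1 ?_, hy⟩
        have := h.zpow_eq_one _ h1
        omega
  · rw [← hsum]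
    exact I.mul_mem_right _ _ (I.mul_mem_left _ _ hb)

end QuantumTriple

end QuantumAgeing

/-! ### Maximal ideals of a quantum triple and maximal ideals of `F[z]`. -/

namespace QuantumAgeing

universe u v w

/-- The quotient map by a two-sided ideal, as an algebra homomorphism. -/
def quotientMap (F : Type u) [Field F] {B : Type v} [Ring B] [Algebra F B]
    (I : TwoSidedIdeal B) : B →ₐ[F] I.ringCon.Quotient :=
  { I.ringCon.mk' with commutes' := fun _ => rfl }

theorem quotientMap_surjective (F : Type u) [Field F] {B : Type v} [Ring B] [Algebra F B]
    (I : TwoSidedIdeal B) : Function.Surjective (quotientMap F I) :=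
  I.ringCon.mk'_surjective

theorem quotientMap_eq_zero_iff (F : Type u) [Field F] {B : Type v} [Ring B] [Algebra F B]
    (I : TwoSidedIdeal B) (x : B) : quotientMap F I x = 0 ↔ x ∈ I :=
  mk'_eq_zero_iff I x

variable {F : Type u} [Field F] {B : Type v} [Ring B] [Algebra F B]

theorem exists_eq_algebraMap_add_mul {z x : B} (hx : x ∈ Algebra.adjoin F {z}) :
    ∃ (r : F), ∃ a ∈ Algebra.adjoin F {z}, x = algebraMap F B r + a * z := by
  rw [Algebra.adjoin_singleton_eq_range_aeval] at hx ⊢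
  obtain ⟨f, rfl⟩ := hx
  refine ⟨f.coeff 0, _, ⟨f.divX, rfl⟩, ?_⟩
  change Polynomial.aeval z f = _ + Polynomial.aeval z f.divX * z
  conv_lhs => rw [← Polynomial.divX_mul_X_add f]
  simp [add_comm]

theorem eq_span_singleton_of_mem {z : B} {𝔮 : Ideal (Algebra.adjoin F {z})} (h𝔮 : 𝔮 ≠ ⊤)
    (hz : ⟨z, Algebra.self_mem_adjoin_singleton F z⟩ ∈ 𝔮) :
    𝔮 = Ideal.span {⟨z, Algebra.self_mem_adjoin_singleton F z⟩} := by
  refine le_antisymm (fun x hx => ?_) ((Ideal.span_singleton_le_iff_mem _).2 hz)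
  obtain ⟨r, a, ha, hra⟩ := exists_eq_algebraMap_add_mul x.2
  have hx' : x = algebraMap F _ r + ⟨a, ha⟩ * ⟨z, Algebra.self_mem_adjoin_singleton F z⟩ :=
    Subtype.ext hra
  have hr : algebraMap F (Algebra.adjoin F {z}) r ∈ 𝔮 := by
    rw [← sub_eq_of_eq_add hx']
    exact 𝔮.sub_mem hx (𝔮.mul_mem_left _ hz)
  have hr0 : r = 0 := by
    by_contra hr0
    refine h𝔮 ((Ideal.eq_top_iff_one _).2 ?_)
    have := 𝔮.mul_mem_left (algebraMap F _ r⁻¹) hr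
    rwa [← map_mul, inv_mul_cancel₀ hr0, map_one] at this
  rw [hx', hr0, map_zero, zero_add]
  exact Ideal.mul_mem_left _ _ (Ideal.mem_span_singleton_self _)

theorem exists_mul_add_eq_one {S : Type v} [Semiring S] {𝔮 : Ideal S} (h : 𝔮.IsMaximal) {x : S}
    (hx : x ∉ 𝔮) : ∃ y, ∃ b ∈ 𝔮, y * x + b = 1 := by
  have htop : Ideal.span {x} ⊔ 𝔮 = ⊤ := by
    refine h.1.2 _ (lt_of_le_of_ne le_sup_right fun he => hx ?_)
    rw [he]
    exact Ideal.mem_sup_left (Ideal.mem_span_singleton_self x)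
  obtain ⟨a, ha, b, hb, hab⟩ := Submodule.mem_sup.1 ((Ideal.eq_top_iff_one _).1 htop)
  obtain ⟨y, rfl⟩ := Ideal.mem_span_singleton'.1 ha
  exact ⟨y, b, hb, hab⟩

theorem exists_mul_sub_one_mem {S : Type v} [Ring S] {𝔮 : Ideal S} (h : 𝔮.IsMaximal) {x : S}
    (hx : x ∉ 𝔮) : ∃ y, y * x - 1 ∈ 𝔮 := by
  obtain ⟨y, b, hb, h1⟩ := exists_mul_add_eq_one h hx
  refine ⟨y, ?_⟩
  rw [← h1, sub_add_cancel_left]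
  exact 𝔮.neg_mem hb

/-- Let `L` be `F[X]` modulo the pullback of `𝔮`, and let `z` act as the class of `X`. The
representation kills `𝔮`, hence the ideal it generates, but not `1` because `L` is nonzero. Pulling
back to polynomials makes it unnecessary to know that `z` is transcendental. -/
theorem one_notMem_span_of_representation {D : Type u} [Ring D] [Algebra F D] {z : D}
    (hρ : ∀ (L : Type u) [CommRing L] [Algebra F L] (t : L),
      ∃ ρ : D →ₐ[F] Module.End L (ℤ → L), ρ z = algebraMap L _ t)
    {𝔮 : Ideal (Algebra.adjoin F {z})} (h𝔮 : 𝔮 ≠ ⊤) :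
    (1 : D) ∉ TwoSidedIdeal.span (Subtype.val '' (𝔮 : Set (Algebra.adjoin F {z}))) := by
  set f : Polynomial F →ₐ[F] Algebra.adjoin F {z} :=
    Polynomial.aeval ⟨z, Algebra.self_mem_adjoin_singleton F z⟩ with hf
  set 𝔮' : Ideal (Polynomial F) := 𝔮.comap f with h𝔮'
  obtain ⟨ρ, hρz⟩ := hρ (Polynomial F ⧸ 𝔮') (Ideal.Quotient.mk 𝔮' Polynomial.X)
  have hker : TwoSidedIdeal.span (Subtype.val '' (𝔮 : Set (Algebra.adjoin F {z}))) ≤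
      TwoSidedIdeal.ker ρ := by
    rw [TwoSidedIdeal.span_le]
    rintro _ ⟨⟨s, hs⟩, hs𝔮, rfl⟩
    have hs' := hs
    rw [Algebra.adjoin_singleton_eq_range_aeval] at hs'
    obtain ⟨g, hg⟩ := hs'
    have hfg : f g = ⟨s, hs⟩ := by
      refine Subtype.ext ?_
      exact (Polynomial.aeval_algHom_apply (Algebra.adjoin F {z}).val _ g).symm.trans hg
    have hg' : g ∈ 𝔮' := by
      rw [h𝔮', Ideal.mem_comap, hfg]; exact hs𝔮
    have hmk : Polynomial.aeval (Ideal.Quotient.mk 𝔮' Polynomial.X) g = 0 := by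
      have := Polynomial.aeval_algHom_apply (Ideal.Quotient.mkₐ F 𝔮') Polynomial.X g
      rw [Polynomial.aeval_X_left_apply] at this
      exact this.trans (Ideal.Quotient.eq_zero_iff_mem.2 hg')
    rw [SetLike.mem_coe, TwoSidedIdeal.mem_ker]
    change ρ s = 0
    rw [← hg]
    change ρ (Polynomial.aeval z g) = 0
    rw [← Polynomial.aeval_algHom_apply, hρz, Polynomial.aeval_algebraMap_apply, hmk, map_zero]
  intro h1
  have h0 := (TwoSidedIdeal.mem_ker ρ).1 (hker h1)
  rw [map_one] at h0
  -- Testing `1 = 0` on the constant sequence `1` at index `0` gives `1 = 0` in `L`.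
  have h2 := congrFun (LinearMap.congr_fun h0 (fun _ => 1)) 0
  have h3 : (Ideal.Quotient.mk 𝔮' 1) = 0 := h2
  rw [Ideal.Quotient.eq_zero_iff_mem, h𝔮', Ideal.mem_comap, map_one] at h3
  exact h𝔮 ((Ideal.eq_top_iff_one _).2 h3)

theorem coe_notMem_span {S : Subalgebra F B} {𝔮 : Ideal S} (hm : 𝔮.IsMaximal)
    (h1 : (1 : B) ∉ TwoSidedIdeal.span (Subtype.val '' (𝔮 : Set S))) {s : S} (hs : s ∉ 𝔮) :
    (s : B) ∉ TwoSidedIdeal.span (Subtype.val '' (𝔮 : Set S)) := by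
  intro hsJ
  obtain ⟨a, ha⟩ := exists_mul_sub_one_mem hm hs
  refine h1 ?_
  have := TwoSidedIdeal.sub_mem _ (TwoSidedIdeal.mul_mem_left _ (a : B) _ hsJ)
    (TwoSidedIdeal.subset_span ⟨_, ha, rfl⟩)
  simpa using this

theorem generator_notMem_span {z : B} {𝔮 : Ideal (Algebra.adjoin F {z})} (hm : 𝔮.IsMaximal)
    (hne : 𝔮 ≠ Ideal.span {⟨z, Algebra.self_mem_adjoin_singleton F z⟩})
    (h1 : (1 : B) ∉ TwoSidedIdeal.span (Subtype.val '' (𝔮 : Set (Algebra.adjoin F {z})))) :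
    z ∉ TwoSidedIdeal.span (Subtype.val '' (𝔮 : Set (Algebra.adjoin F {z}))) :=
  coe_notMem_span hm h1 (s := ⟨z, Algebra.self_mem_adjoin_singleton F z⟩)
    fun hz => hne (eq_span_singleton_of_mem hm.ne_top hz)

namespace QuantumTriple

variable {p c : F} {k : Bˣ} {y e z : B}

/-- The quotient is again a quantum triple. Its `z` is nonzero because `𝔮 ≠ (z)`, and nonzero
elements of the image of `F[z]` are invertible there because `𝔮` is maximal, so `isSimpleRing`
applies. -/
theorem isCoatom_span (h : QuantumTriple p c k y e z) {𝔮 : Ideal (Algebra.adjoin F {z})}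
    (hm : 𝔮.IsMaximal) (hne : 𝔮 ≠ Ideal.span {⟨z, Algebra.self_mem_adjoin_singleton F z⟩})
    (h1 : (1 : B) ∉ TwoSidedIdeal.span (Subtype.val '' (𝔮 : Set (Algebra.adjoin F {z})))) :
    IsCoatom (TwoSidedIdeal.span (Subtype.val '' (𝔮 : Set (Algebra.adjoin F {z})))) := by
  have hz := generator_notMem_span hm hne h1
  have hmem := fun s (hs : s ∉ 𝔮) => coe_notMem_span hm h1 hs
  set J := TwoSidedIdeal.span (Subtype.val '' (𝔮 : Set (Algebra.adjoin F {z}))) with hJ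
  rw [← isSimpleRing_quotient_iff]
  have hπ := quotientMap_eq_zero_iff F J
  have hmap := h.map (quotientMap F J) (quotientMap_surjective F J)
  have : Nontrivial J.ringCon.Quotient :=
    ⟨⟨1, 0, fun h0 => h1 ((hπ 1).1 (by rw [map_one]; exact h0))⟩⟩
  refine hmap.isSimpleRing (fun h0 => hz ((hπ z).1 h0)) fun l hl hl0 => ?_
  rw [← Set.image_singleton, ← AlgHom.map_adjoin] at hl ⊢
  obtain ⟨s, hs, rfl⟩ := hl
  have hs𝔮 : (⟨s, hs⟩ : Algebra.adjoin F {z}) ∉ 𝔮 := fun hs𝔮 =>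
    hl0 ((hπ s).2 (TwoSidedIdeal.subset_span ⟨_, hs𝔮, rfl⟩))
  obtain ⟨a, ha⟩ := exists_mul_sub_one_mem hm hs𝔮
  refine ⟨_, ⟨a, a.2, rfl⟩, ?_⟩
  have := (hπ (a * s - 1)).2 (TwoSidedIdeal.subset_span ⟨_, ha, rfl⟩)
  rw [map_sub, map_mul, map_one, sub_eq_zero] at this
  exact this

theorem skew_y_generators (h : QuantumTriple p c k y e z) :
    ∀ g ∈ ({(k : B), (↑k⁻¹ : B), y, e} : Set B), ∃ r : F, r ≠ 0 ∧ Skew r y g := by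
  rintro _ (rfl | rfl | rfl | rfl)
  exacts [⟨_, h.ne_zero, h.skew_y_k⟩, ⟨_, inv_ne_zero h.ne_zero, h.skew_y_k.inv_right h.ne_zero⟩,
    ⟨_, one_ne_zero, Skew.refl _⟩, ⟨_, inv_ne_zero h.ne_zero, h.skew_y_e⟩]

theorem skew_e_generators (h : QuantumTriple p c k y e z) :
    ∀ g ∈ ({(k : B), (↑k⁻¹ : B), y, e} : Set B), ∃ r : F, r ≠ 0 ∧ Skew r e g := by
  have hp := pow_ne_zero 2 (inv_ne_zero h.ne_zero)
  rintro _ (rfl | rfl | rfl | rfl)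
  exacts [⟨_, hp, h.skew_e_k⟩, ⟨_, inv_ne_zero hp, h.skew_e_k.inv_right hp⟩,
    ⟨_, h.ne_zero, h.skew_e_y⟩, ⟨_, one_ne_zero, Skew.refl _⟩]

/-- Take `𝔮 = N ∩ F[z]`. In the simple quotient `y` and `e` are normal and nonzero, hence units; so
`z` is a unit and `𝔮 ≠ (z)`, while `exists_mul_eq_one` makes `𝔮` maximal. The ideal generated by `𝔮`
is then maximal and contained in `N`. -/
theorem exists_eq_span (h : QuantumTriple p c k y e z) {N : TwoSidedIdeal B} (hN : IsCoatom N)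
    (hy : y ∉ N) (he : e ∉ N) : ∃ 𝔮 : Ideal (Algebra.adjoin F {z}), 𝔮.IsMaximal ∧
      𝔮 ≠ Ideal.span {⟨z, Algebra.self_mem_adjoin_singleton F z⟩} ∧
      N = TwoSidedIdeal.span (Subtype.val '' (𝔮 : Set (Algebra.adjoin F {z}))) := by
  have : IsSimpleRing N.ringCon.Quotient := (isSimpleRing_quotient_iff N).2 hN
  have hπ := quotientMap_eq_zero_iff F N
  have hmap := h.map (quotientMap F N) (quotientMap_surjective F N)
  have hyu := isUnit_of_skew hmap.adjoin_eq_top hmap.skew_y_generators (mt (hπ y).1 hy)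
  have heu := isUnit_of_skew hmap.adjoin_eq_top hmap.skew_e_generators (mt (hπ e).1 he)
  have hzN : z ∉ N := fun hz => by
    have h0 := hmap.z_eq
    rw [(hπ z).2 hz, eq_comm, smul_eq_zero_iff_right h.coeff_ne_zero] at h0
    exact (((hyu.mul hyu).mul heu).mul (Units.isUnit _)).ne_zero h0
  set 𝔮 : Ideal (Algebra.adjoin F {z}) :=
    (TwoSidedIdeal.asIdeal N).comap (Algebra.adjoin F {z}).val with h𝔮
  have hmem : ∀ s, s ∈ 𝔮 ↔ (s : B) ∈ N := fun s => Iff.rfl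
  have hm : 𝔮.IsMaximal := by
    rw [Ideal.isMaximal_iff]
    refine ⟨fun h1 => hN.1 ((TwoSidedIdeal.one_mem_iff _).1 h1), fun I s hI hs hsI => ?_⟩
    have hs0 : quotientMap F N s ≠ 0 := mt (hπ s).1 hs
    have hsm : quotientMap F N s ∈ Algebra.adjoin F {quotientMap F N z} := by
      rw [← Set.image_singleton, ← AlgHom.map_adjoin]
      exact ⟨s, s.2, rfl⟩
    obtain ⟨l, hl, hls⟩ := hmap.exists_mul_eq_one hyu hsm hs0
    rw [← Set.image_singleton, ← AlgHom.map_adjoin] at hl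
    obtain ⟨a, ha, rfl⟩ := hl
    have h1 : (⟨a, ha⟩ * s - 1 : Algebra.adjoin F {z}) ∈ 𝔮 := by
      rw [hmem, ← hπ]
      change quotientMap F N (a * s - 1) = 0
      rw [map_sub, map_mul, map_one, sub_eq_zero]
      exact hls
    have := I.sub_mem (I.mul_mem_left ⟨a, ha⟩ hsI) (hI h1)
    rwa [sub_sub_cancel] at this
  have hne : 𝔮 ≠ Ideal.span {⟨z, Algebra.self_mem_adjoin_singleton F z⟩} := fun he => hzN (by
    rw [← hmem ⟨z, Algebra.self_mem_adjoin_singleton F z⟩, he]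
    exact Ideal.mem_span_singleton_self _)
  have hle : TwoSidedIdeal.span (Subtype.val '' (𝔮 : Set (Algebra.adjoin F {z}))) ≤ N := by
    rw [TwoSidedIdeal.span_le]
    rintro _ ⟨s, hs, rfl⟩
    exact hs
  -- Properness comes from `N` here, so no representation is needed in this direction.
  have h1 := fun h1 => hN.1 ((TwoSidedIdeal.one_mem_iff _).1 (hle h1))
  exact ⟨𝔮, hm, hne, ((h.isCoatom_span hm hne h1).le_iff_eq hN.1).1 hle⟩

end QuantumTriple

end QuantumAgeing

/-! ### Consequences of the defining relations in simple quotients and modulo `X` or `φ`. -/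

namespace QuantumAgeing

universe u v w

/-- Elements of an algebra that satisfy the defining relations of the quantum spatial ageing
algebra and generate. -/
structure AgeingSystem {F : Type u} [Field F] {B : Type v} [Ring B] [Algebra F B] (q : F) (k : Bˣ)
    (e x y : B) : Prop where
  ne_zero : q ≠ 0
  zpow_eq_one : ∀ n : ℤ, q ^ n = 1 → n = 0
  skew_e_k : Skew (q⁻¹ ^ 2) e (k : B)
  skew_x_k : Skew q⁻¹ x (k : B)
  skew_y_k : Skew q y (k : B)
  skew_e_x : Skew q e x
  e_mul_y : e * y = x + q⁻¹ • (y * e)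
  skew_x_y : Skew q x y
  adjoin_eq_top : Algebra.adjoin F {(k : B), (↑k⁻¹ : B), e, x, y} = ⊤

namespace AgeingSystem

variable {F : Type u} [Field F] {B : Type v} [Ring B] [Algebra F B] {q : F} {k : Bˣ} {e x y : B}

theorem map {C : Type w} [Ring C] [Algebra F C] (h : AgeingSystem q k e x y) (f : B →ₐ[F] C)
    (hf : Function.Surjective f) :
    AgeingSystem q (Units.map (f : B →* C) k) (f e) (f x) (f y) where
  ne_zero := h.ne_zero
  zpow_eq_one := h.zpow_eq_one
  skew_e_k := h.skew_e_k.map f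
  skew_x_k := h.skew_x_k.map f
  skew_y_k := h.skew_y_k.map f
  skew_e_x := h.skew_e_x.map f
  e_mul_y := by rw [← map_mul, h.e_mul_y]; simp
  skew_x_y := h.skew_x_y.map f
  adjoin_eq_top := by
    have := congrArg (Subalgebra.map f) h.adjoin_eq_top
    rw [AlgHom.map_adjoin, Algebra.map_top, (AlgHom.range_eq_top f).2 hf] at this
    rw [← this]
    simp [Set.image_insert_eq]

theorem sub_ne_zero' (h : AgeingSystem q k e x y) : q⁻¹ - q ≠ 0 := by
  intro h0
  have : q ^ (2 : ℤ) = 1 := by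
    rw [sub_eq_zero] at h0
    have := h.ne_zero
    field_simp at h0
    simpa [eq_comm] using h0
  exact absurd (h.zpow_eq_one _ this) (by norm_num)

theorem x_eq (h : AgeingSystem q k e x y) : x = e * y - q⁻¹ • (y * e) := by
  rw [h.e_mul_y, add_sub_cancel_right]

theorem skew_phi_k (h : AgeingSystem q k e x y) :
    Skew q⁻¹ (x + (q⁻¹ - q) • (y * e)) (k : B) := by
  have hq := h.ne_zero
  have h1 := ((h.skew_y_k.mul_left h.skew_e_k).symm (by positivity)).smul_right (q⁻¹ - q)
  have h2 := (h.skew_x_k.symm (inv_ne_zero hq))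
  rw [show (q * q⁻¹ ^ 2)⁻¹ = q by field_simp] at h1
  rw [inv_inv] at h2
  exact (h2.add_right h1).symm hq

theorem skew_x_e (h : AgeingSystem q k e x y) : Skew q⁻¹ x e := h.skew_e_x.symm h.ne_zero

theorem commute_x_phi (h : AgeingSystem q k e x y) :
    Commute x (x + (q⁻¹ - q) • (y * e)) := by
  have h1 := (h.skew_x_y.mul_right h.skew_x_e).smul_right (q⁻¹ - q)
  rw [mul_inv_cancel₀ h.ne_zero] at h1
  exact skew_one_iff.1 ((Skew.refl x).add_right h1)

theorem skew_phi_y (h : AgeingSystem q k e x y) : Skew q⁻¹ (x + (q⁻¹ - q) • (y * e)) y := by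
  have hq := h.ne_zero
  have hxy : x * y = q • (y * x) := h.skew_x_y
  rw [Skew, add_mul, smul_mul_assoc, mul_assoc y e y, h.e_mul_y, hxy]
  simp only [mul_add, mul_smul_comm, smul_add, smul_smul]
  rw [← add_assoc, ← add_smul]
  congr 2
  · ring
  · ring

theorem skew_phi_e (h : AgeingSystem q k e x y) : Skew q (x + (q⁻¹ - q) • (y * e)) e := by
  have hq := h.ne_zero
  have hxe : e * x = q • (x * e) := h.skew_e_x
  rw [Skew, mul_add, mul_smul_comm, ← mul_assoc e y e, h.e_mul_y, hxe]
  simp only [add_mul, smul_mul_assoc, smul_add, smul_smul]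
  rw [← add_assoc, ← add_smul, show q * q + q * (q⁻¹ - q) = 1 by field_simp; ring, one_smul,
    show q * ((q⁻¹ - q) * q⁻¹) = q⁻¹ - q by field_simp]

theorem skew_x_generators (h : AgeingSystem q k e x y) :
    ∀ g ∈ ({(k : B), (↑k⁻¹ : B), e, x, y} : Set B), ∃ r : F, r ≠ 0 ∧ Skew r x g := by
  have hq := inv_ne_zero h.ne_zero
  rintro _ (rfl | rfl | rfl | rfl | rfl)
  exacts [⟨_, hq, h.skew_x_k⟩, ⟨_, inv_ne_zero hq, h.skew_x_k.inv_right hq⟩, ⟨_, hq, h.skew_x_e⟩,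
    ⟨_, one_ne_zero, Skew.refl _⟩, ⟨_, h.ne_zero, h.skew_x_y⟩]

theorem skew_phi_generators (h : AgeingSystem q k e x y) :
    ∀ g ∈ ({(k : B), (↑k⁻¹ : B), e, x, y} : Set B),
      ∃ r : F, r ≠ 0 ∧ Skew r (x + (q⁻¹ - q) • (y * e)) g := by
  have hq := inv_ne_zero h.ne_zero
  rintro g (rfl | rfl | rfl | rfl | rfl)
  exacts [⟨_, hq, h.skew_phi_k⟩, ⟨_, inv_ne_zero hq, h.skew_phi_k.inv_right hq⟩,
    ⟨_, h.ne_zero, h.skew_phi_e⟩, ⟨_, one_ne_zero, skew_one_iff.2 h.commute_x_phi.symm⟩,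
    ⟨_, hq, h.skew_phi_y⟩]

/-- Here `i` is the net exponent of `k` in the word `v`, and `l`, `m`, `n` count its letters `x`,
`y`, `e`. That the last three are natural numbers is what later excludes trivial weight. -/
theorem exists_weight (h : AgeingSystem q k e x y) {v : B}
    (hv : v ∈ Submonoid.closure {(k : B), (↑k⁻¹ : B), e, x, y}) :
    ∃ (i : ℤ) (l m n : ℕ), Skew (q ^ (l - m + 2 * n : ℤ)) (k : B) v ∧ Skew (q ^ (m - i - n : ℤ)) x v ∧
      Skew (q ^ (n - i - m : ℤ)) (x + (q⁻¹ - q) • (y * e)) v := by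
  have hq := h.ne_zero
  have hq' := inv_ne_zero hq
  have hk1 : Skew q⁻¹ (k : B) y := h.skew_y_k.symm hq
  have hk2 : Skew (q ^ 2) (k : B) e := by simpa using h.skew_e_k.symm (pow_ne_zero 2 hq')
  have hk3 : Skew q (k : B) x := by simpa using h.skew_x_k.symm hq'
  have hx1 := h.skew_x_k.inv_right hq'
  have hf1 := h.skew_phi_k.inv_right hq'
  have hkk : Skew (1 : F) (k : B) (↑k⁻¹ : B) :=
    skew_one_iff.2 (Commute.refl (k : B)).units_inv_right
  induction hv using Submonoid.closure_induction_left with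
  | one =>
    exact ⟨0, 0, 0, 0, by simpa using skew_one_right _, by simpa using skew_one_right _,
      by simpa using skew_one_right _⟩
  | mul_left g hg v _ ih =>
    obtain ⟨i, l, m, n, h1, h2, h3⟩ := ih
    have key : ∀ (i' : ℤ) (l' m' n' : ℕ), Skew (q ^ (l' - m' + 2 * n' : ℤ)) (k : B) g →
        Skew (q ^ (m' - i' - n' : ℤ)) x g →
        Skew (q ^ (n' - i' - m' : ℤ)) (x + (q⁻¹ - q) • (y * e)) g →
        ∃ (i : ℤ) (l m n : ℕ), Skew (q ^ (l - m + 2 * n : ℤ)) (k : B) (g * v) ∧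
          Skew (q ^ (m - i - n : ℤ)) x (g * v) ∧
          Skew (q ^ (n - i - m : ℤ)) (x + (q⁻¹ - q) • (y * e)) (g * v) := by
      intro i' l' m' n' h1' h2' h3'
      refine ⟨i' + i, l' + l, m' + m, n' + n, ?_, ?_, ?_⟩
      · convert h1'.mul_right h1 using 1
        rw [← zpow_add₀ hq]; congr 1; push_cast; ring
      · convert h2'.mul_right h2 using 1
        rw [← zpow_add₀ hq]; congr 1; push_cast; ring
      · convert h3'.mul_right h3 using 1
        rw [← zpow_add₀ hq]; congr 1; push_cast; ring
    obtain rfl | rfl | rfl | rfl | rfl := hg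
    · exact key 1 0 0 0 (by simpa using Skew.refl _) (by simpa using h.skew_x_k)
        (by simpa using h.skew_phi_k)
    · exact key (-1) 0 0 0 (by simpa using hkk) (by simpa using hx1) (by simpa using hf1)
    · exact key 0 0 0 1 (by simpa using hk2) (by simpa using h.skew_x_e)
        (by simpa using h.skew_phi_e)
    · exact key 0 1 0 0 (by simpa using hk3) (by simpa using Skew.refl _)
        (by simpa using skew_one_iff.2 h.commute_x_phi.symm)
    · exact key 0 0 1 0 (by simpa using hk1) (by simpa using h.skew_x_y)
        (by simpa using h.skew_phi_y)

theorem x_eq_zero_or_phi_eq_zero [IsSimpleRing B] (h : AgeingSystem q k e x y) :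
    x = 0 ∨ x + (q⁻¹ - q) • (y * e) = 0 := by
  by_contra! hne
  obtain ⟨hx, hφ⟩ := hne
  have hq := h.ne_zero
  refine hx (eq_zero_of_mul_mem_nontrivialWeights h.adjoin_eq_top h.skew_x_generators
    (U := {(k : B), x, x + (q⁻¹ - q) • (y * e)}) (fun _ => ?_) fun v hv => ?_)
  · rintro _ (rfl | rfl | rfl)
    exacts [k.isUnit, isUnit_of_skew h.adjoin_eq_top h.skew_x_generators hx,
      isUnit_of_skew h.adjoin_eq_top h.skew_phi_generators hφ]
  · obtain ⟨i, l, m, n, h1, h2, h3⟩ := h.exists_weight hv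
    have hkx : Skew q (k : B) x := by simpa using h.skew_x_k.symm (inv_ne_zero hq)
    replace h1 := hkx.mul_right h1
    replace h2 := (Skew.refl (F := F) x).mul_right h2
    replace h3 := (skew_one_iff (F := F).2 h.commute_x_phi.symm).mul_right h3
    rw [← zpow_one_add₀ hq] at h1
    rw [one_mul] at h2 h3
    refine Submodule.subset_span ⟨?_, ?_⟩
    · rintro _ (rfl | rfl | rfl)
      exacts [⟨_, h1⟩, ⟨_, h2⟩, ⟨_, h3⟩]
    -- If all three weights of `x * v` were trivial, then `m - i - n = 0` and `n - i - m = 0` would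
    -- give `i = 0` and `m = n`, leaving `1 + l + n = 0`, which is impossible.
    · by_cases e1 : (1 + (l - m + 2 * n) : ℤ) = 0
      · by_cases e2 : (m - i - n : ℤ) = 0
        · refine ⟨_, Or.inr (Or.inr rfl), _, fun h0 => ?_, h3⟩
          have := h.zpow_eq_one _ h0
          omega
        · exact ⟨_, Or.inr (Or.inl rfl), _, fun h0 => e2 (h.zpow_eq_one _ h0), h2⟩
      · exact ⟨_, Or.inl rfl, _, fun h0 => e1 (h.zpow_eq_one _ h0), h1⟩

/-- Grade by the `k`-weight in powers of `r`: the generators have nonnegative degree and `a`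
positive degree, so every product of `a` with a word has positive degree, hence nontrivial weight.
-/
theorem eq_zero_of_skew_pow [IsSimpleRing B] {r : F} (hr : ∀ n : ℕ, r ^ n = 1 → n = 0)
    {s : Set B} (hs : Algebra.adjoin F s = ⊤) {a : B}
    (ha : ∀ g ∈ s, ∃ c : F, c ≠ 0 ∧ Skew c a g) (hk : ∃ n : ℕ, Skew (r ^ (n + 1)) (k : B) a)
    (hg : ∀ g ∈ s, ∃ n : ℕ, Skew (r ^ n) (k : B) g) : a = 0 := by
  refine eq_zero_of_mul_mem_nontrivialWeights hs ha (U := {(k : B)}) (fun _ => ?_) fun v hv => ?_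
  · rintro _ rfl
    exact k.isUnit
  · have hv' : ∃ n : ℕ, Skew (r ^ n) (k : B) v := by
      induction hv using Submonoid.closure_induction with
      | mem g h => exact hg g h
      | one => exact ⟨0, by simpa using skew_one_right _⟩
      | mul v w _ _ hv hw =>
        obtain ⟨m, hv⟩ := hv
        obtain ⟨n, hw⟩ := hw
        exact ⟨m + n, by rw [pow_add]; exact hv.mul_right hw⟩
    obtain ⟨m, hm⟩ := hk
    obtain ⟨n, hn⟩ := hv'
    have := hm.mul_right hn
    rw [← pow_add] at this
    refine Submodule.subset_span ⟨?_, _, rfl, _, fun h0 => ?_, this⟩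
    · rintro _ rfl
      exact ⟨_, this⟩
    · have := hr _ h0
      omega

/-- If one of `e`, `y` vanishes, so does `x = e * y - q⁻¹ • (y * e)`. The other is then normal, of
`k`-degree `1` for the base `q⁻¹` (`y`) or `2` for the base `q` (`e`), and the degree argument kills
it. -/
theorem e_eq_zero_iff [IsSimpleRing B] (h : AgeingSystem q k e x y) : e = 0 ↔ y = 0 := by
  have hq := h.ne_zero
  have hq' := inv_ne_zero hq
  have hroot : ∀ n : ℕ, q ^ n = 1 → n = 0 := fun n hn => by
    have := h.zpow_eq_one n (by simpa using hn)
    omega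
  have hkk : Skew (1 : F) (k : B) (↑k⁻¹ : B) :=
    skew_one_iff.2 (Commute.refl (k : B)).units_inv_right
  constructor
  · rintro rfl
    have hx := h.x_eq
    simp only [zero_mul, mul_zero, smul_zero, sub_zero] at hx
    have hk1 : Skew q⁻¹ (k : B) y := h.skew_y_k.symm hq
    refine eq_zero_of_skew_pow (k := k) (r := q⁻¹) (fun n hn => hroot n (by simpa using hn))
      h.adjoin_eq_top ?_ ⟨0, by simpa using hk1⟩ ?_
    · rintro _ (rfl | rfl | rfl | rfl | rfl)
      exacts [⟨_, hq, h.skew_y_k⟩, ⟨_, hq', h.skew_y_k.inv_right hq⟩,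
        ⟨1, one_ne_zero, skew_zero_right _ _⟩, ⟨1, one_ne_zero, hx ▸ skew_zero_right _ _⟩,
        ⟨1, one_ne_zero, Skew.refl _⟩]
    · rintro _ (rfl | rfl | rfl | rfl | rfl)
      exacts [⟨0, by simpa using Skew.refl _⟩, ⟨0, by simpa using hkk⟩, ⟨0, skew_zero_right _ _⟩,
        ⟨0, hx ▸ skew_zero_right _ _⟩, ⟨1, by simpa using hk1⟩]
  · rintro rfl
    have hx := h.x_eq
    simp only [zero_mul, mul_zero, smul_zero, sub_zero] at hx
    have hk2 : Skew (q ^ 2) (k : B) e := by simpa using h.skew_e_k.symm (pow_ne_zero 2 hq')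
    refine eq_zero_of_skew_pow (k := k) (r := q) hroot h.adjoin_eq_top ?_ ⟨1, hk2⟩ ?_
    · rintro _ (rfl | rfl | rfl | rfl | rfl)
      exacts [⟨_, pow_ne_zero 2 hq', h.skew_e_k⟩,
        ⟨_, inv_ne_zero (pow_ne_zero 2 hq'), h.skew_e_k.inv_right (pow_ne_zero 2 hq')⟩,
        ⟨1, one_ne_zero, Skew.refl _⟩, ⟨1, one_ne_zero, hx ▸ skew_zero_right _ _⟩,
        ⟨1, one_ne_zero, skew_zero_right _ _⟩]
    · rintro _ (rfl | rfl | rfl | rfl | rfl)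
      exacts [⟨0, by simpa using Skew.refl _⟩, ⟨0, by simpa using hkk⟩, ⟨2, hk2⟩,
        ⟨0, hx ▸ skew_zero_right _ _⟩, ⟨0, skew_zero_right _ _⟩]

/-- Modulo `x` the relation becomes `e * y = q⁻¹ • (y * e)`, which forces the parameter `q⁻¹` and
hence the unit `k⁻¹`. -/
theorem quantumTriple_of_x_eq_zero (h : AgeingSystem q k e x y) (hx : x = 0) :
    QuantumTriple q⁻¹ ((q⁻¹ - q) * q⁻¹) k⁻¹ y e ((x + (q⁻¹ - q) • (y * e)) * y * ↑k⁻¹) where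
  ne_zero := inv_ne_zero h.ne_zero
  zpow_eq_one n hn := h.zpow_eq_one n (by simpa using hn)
  coeff_ne_zero := mul_ne_zero h.sub_ne_zero' (inv_ne_zero h.ne_zero)
  skew_y_k := h.skew_y_k.inv_right h.ne_zero
  skew_e_k := by
    have := h.skew_e_k.inv_right (pow_ne_zero 2 (inv_ne_zero h.ne_zero))
    rwa [← inv_pow] at this
  skew_e_y := by rw [Skew, h.e_mul_y, hx, zero_add]
  z_eq := by
    rw [hx, zero_add, smul_mul_assoc, mul_assoc y e y, h.e_mul_y, hx, zero_add]
    simp only [mul_smul_comm, smul_mul_assoc, smul_smul, mul_assoc]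
  adjoin_eq_top := by
    rw [inv_inv, eq_top_iff, ← h.adjoin_eq_top, Algebra.adjoin_le_iff]
    rintro _ (rfl | rfl | rfl | rfl | rfl)
    · exact Algebra.subset_adjoin (by simp)
    · exact Algebra.subset_adjoin (by simp)
    · exact Algebra.subset_adjoin (by simp)
    · rw [hx]; exact zero_mem _
    · exact Algebra.subset_adjoin (by simp)

/-- Modulo `φ` the generator `x` is a multiple of `y * e`, and the relation becomes `e * y = q • (y
* e)`. -/
theorem quantumTriple_of_phi_eq_zero (h : AgeingSystem q k e x y)
    (hφ : x + (q⁻¹ - q) • (y * e) = 0) :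
    QuantumTriple q (-(q⁻¹ - q) * q) k y e (x * y * k) := by
  have hx : x = -(q⁻¹ - q) • (y * e) := by rw [neg_smul]; exact eq_neg_of_add_eq_zero_left hφ
  have hey : e * y = q • (y * e) := by
    rw [h.e_mul_y, hx, ← add_smul]; congr 1; ring
  refine ⟨h.ne_zero, h.zpow_eq_one, mul_ne_zero (neg_ne_zero.2 h.sub_ne_zero') h.ne_zero,
    h.skew_y_k, h.skew_e_k, hey, ?_, ?_⟩
  · rw [hx, smul_mul_assoc, mul_assoc y e y, hey]
    simp only [mul_smul_comm, smul_mul_assoc, smul_smul, mul_assoc]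
  · rw [eq_top_iff, ← h.adjoin_eq_top, Algebra.adjoin_le_iff]
    rintro _ (rfl | rfl | rfl | rfl | rfl)
    · exact Algebra.subset_adjoin (by simp)
    · exact Algebra.subset_adjoin (by simp)
    · exact Algebra.subset_adjoin (by simp)
    · rw [hx]
      exact Subalgebra.smul_mem _ (mul_mem (Algebra.subset_adjoin (by simp))
        (Algebra.subset_adjoin (by simp))) _
    · exact Algebra.subset_adjoin (by simp)

end AgeingSystem

end QuantumAgeing

/-! ### The presented algebra and its universal property. -/

namespace QuantumAgeing

universe u v w

section Lift

variable {F : Type u} [Field F] {q : F}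

theorem exists_algHom {R : Type v} [Ring R] [Algebra F R] (e k k' x y : R)
    (hkk' : k * k' = 1) (hk'k : k' * k = 1) (hek : e * k = (q⁻¹ ^ 2) • (k * e))
    (hxk : x * k = q⁻¹ • (k * x)) (hyk : y * k = q • (k * y)) (hex : e * x = q • (x * e))
    (hey : e * y = x + q⁻¹ • (y * e)) (hyx : q • (y * x) = x * y) :
    ∃ ρ : Alg F q →ₐ[F] R, ρ (elE F q) = e ∧ ρ (elK F q) = k ∧ ρ (elKinv F q) = k' ∧
      ρ (elX F q) = x ∧ ρ (elY F q) = y := by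
  let g : Gen → R := fun a => match a with
    | Gen.E => e
    | Gen.K => k
    | Gen.Kinv => k'
    | Gen.X => x
    | Gen.Y => y
  have hg : ∀ a b, Rel F q a b → FreeAlgebra.lift F g a = FreeAlgebra.lift F g b := by
    rintro _ _ (_ | _) <;>
      simpa only [map_mul, map_one, map_add, map_smul, FreeAlgebra.lift_ι_apply, g]
  have hρ : ∀ a, RingQuot.liftAlgHom F ⟨FreeAlgebra.lift F g, hg⟩ (gen F q a) = g a := fun a => by
    rw [gen, RingQuot.liftAlgHom_mkAlgHom_apply, FreeAlgebra.lift_ι_apply]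
  exact ⟨RingQuot.liftAlgHom F ⟨FreeAlgebra.lift F g, hg⟩, hρ Gen.E, hρ Gen.K, hρ Gen.Kinv,
    hρ Gen.X, hρ Gen.Y⟩

theorem exists_algHom_quotient {B : Type v} [Ring B] [Algebra F B] {R : Type w} [Ring R]
    [Algebra F R] (I : TwoSidedIdeal B) (ρ : B →ₐ[F] R) (h : ∀ x ∈ I, ρ x = 0) :
    ∃ ρ' : I.ringCon.Quotient →ₐ[F] R, ∀ x, ρ' (I.ringCon.mk' x) = ρ x := by
  refine ⟨{ RingCon.lift (ρ : B →+* R) (c := I.ringCon) (fun x y hxy => ?_) with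
    commutes' := fun r => ρ.commutes r }, fun _ => rfl⟩
  have := h _ ((TwoSidedIdeal.rel_iff I x y).1 hxy)
  rw [map_sub, sub_eq_zero] at this
  exact this

variable (F q)

/-- The generator `K` as a unit. -/
def unitK : (Alg F q)ˣ where
  val := elK F q
  inv := elKinv F q
  val_inv := by
    have := RingQuot.mkAlgHom_rel F (Rel.K_mul_Kinv (F := F) (q := q))
    rwa [map_mul, map_one] at this
  inv_val := by
    have := RingQuot.mkAlgHom_rel F (Rel.Kinv_mul_K (F := F) (q := q))
    rwa [map_mul, map_one] at this

theorem adjoin_generators :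
    Algebra.adjoin F {elK F q, elKinv F q, elE F q, elX F q, elY F q} = ⊤ := by
  have h := congrArg (Subalgebra.map (RingQuot.mkAlgHom F (Rel F q)))
    (FreeAlgebra.adjoin_range_ι F Gen)
  rw [AlgHom.map_adjoin, Algebra.map_top,
    (AlgHom.range_eq_top _).2 (RingQuot.mkAlgHom_surjective F (Rel F q))] at h
  rw [eq_top_iff, ← h, Algebra.adjoin_le_iff]
  rintro _ ⟨_, ⟨g, rfl⟩, rfl⟩
  refine Algebra.subset_adjoin ?_
  change gen F q g ∈ _
  cases g <;> simp [elK, elKinv, elE, elX, elY]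

variable {F q}

theorem zpow_eq_one_of_not_root (hq : ∀ n : ℕ, 0 < n → q ^ n ≠ 1) (n : ℤ) (hn : q ^ n = 1) :
    n = 0 := by
  by_contra h0
  refine hq n.natAbs (Int.natAbs_pos.2 h0) ?_
  obtain h | h := Int.natAbs_eq n
  · rwa [h, zpow_natCast] at hn
  · rwa [h, zpow_neg, inv_eq_one, zpow_natCast] at hn

theorem ageingSystem (hq0 : q ≠ 0) (hq : ∀ n : ℕ, 0 < n → q ^ n ≠ 1) :
    AgeingSystem q (unitK F q) (elE F q) (elX F q) (elY F q) where
  ne_zero := hq0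
  zpow_eq_one := zpow_eq_one_of_not_root hq
  skew_e_k := by
    have := RingQuot.mkAlgHom_rel F (Rel.E_mul_K (F := F) (q := q))
    rwa [map_mul, map_smul, map_mul] at this
  skew_x_k := by
    have := RingQuot.mkAlgHom_rel F (Rel.X_mul_K (F := F) (q := q))
    rwa [map_mul, map_smul, map_mul] at this
  skew_y_k := by
    have := RingQuot.mkAlgHom_rel F (Rel.Y_mul_K (F := F) (q := q))
    rwa [map_mul, map_smul, map_mul] at this
  skew_e_x := by
    have := RingQuot.mkAlgHom_rel F (Rel.E_mul_X (F := F) (q := q))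
    rwa [map_mul, map_smul, map_mul] at this
  e_mul_y := by
    have := RingQuot.mkAlgHom_rel F (Rel.E_mul_Y (F := F) (q := q))
    rwa [map_mul, map_add, map_smul, map_mul] at this
  skew_x_y := by
    have := RingQuot.mkAlgHom_rel F (Rel.Y_mul_X (F := F) (q := q))
    rw [map_mul, map_smul, map_mul] at this
    exact this.symm
  adjoin_eq_top := adjoin_generators F q

end Lift

/-! ### Shift and diagonal operators on sequences. -/

section Representation

variable {F : Type u} [Field F] {L : Type v} [CommRing L] [Algebra F L]

/-- The diagonal operator with entries `q ^ n`. -/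
def diagonalOp (L : Type v) [CommRing L] [Algebra F L] (q : F) : Module.End L (ℤ → L) where
  toFun f n := q ^ n • f n
  map_add' f g := funext fun n => smul_add _ _ _
  map_smul' a f := funext fun n => by simp

/-- The shift operator. -/
def shiftOp (L : Type v) [CommRing L] : Module.End L (ℤ → L) where
  toFun f n := f (n + 1)
  map_add' _ _ := rfl
  map_smul' _ _ := rfl

/-- The backward double shift with weights `r ^ n * s`. -/
def weightedShiftOp (r : F) (s : L) : Module.End L (ℤ → L) where
  toFun f n := r ^ n • (s * f (n - 2))
  map_add' f g := funext fun n => by simp [mul_add]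
  map_smul' a f := funext fun n => by
    simp only [Pi.smul_apply, smul_eq_mul, RingHom.id_apply, mul_smul_comm]
    rw [mul_left_comm]

theorem diagonalOp_apply (q : F) (f : ℤ → L) (n : ℤ) : diagonalOp L q f n = q ^ n • f n := rfl

theorem shiftOp_apply (f : ℤ → L) (n : ℤ) : shiftOp L f n = f (n + 1) := rfl

theorem weightedShiftOp_apply (r : F) (s : L) (f : ℤ → L) (n : ℤ) :
    weightedShiftOp r s f n = r ^ n • (s * f (n - 2)) := rfl

variable {q : F}

theorem diagonalOp_mul_inv (hq : q ≠ 0) : diagonalOp L q * diagonalOp L q⁻¹ = 1 := by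
  ext f n
  simp [diagonalOp_apply, smul_smul, zpow_ne_zero _ hq]

theorem diagonalOp_inv_mul (hq : q ≠ 0) : diagonalOp L q⁻¹ * diagonalOp L q = 1 := by
  ext f n
  simp [diagonalOp_apply, smul_smul, zpow_ne_zero _ hq]

theorem skew_shiftOp_diagonalOp (hq : q ≠ 0) : Skew q (shiftOp L) (diagonalOp L q) := by
  refine LinearMap.ext fun f => funext fun n => ?_
  simp only [Module.End.mul_apply, LinearMap.smul_apply, Pi.smul_apply, diagonalOp_apply,
    shiftOp_apply, smul_smul, ← zpow_one_add₀ hq, add_comm]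

theorem skew_weightedShiftOp_diagonalOp (hq : q ≠ 0) (r : F) (s : L) :
    Skew (q⁻¹ ^ 2) (weightedShiftOp r s) (diagonalOp L q) := by
  refine LinearMap.ext fun f => funext fun n => ?_
  simp only [Module.End.mul_apply, LinearMap.smul_apply, Pi.smul_apply, diagonalOp_apply,
    weightedShiftOp_apply, smul_smul, mul_smul_comm]
  congr 1
  rw [zpow_sub₀ hq]
  field_simp

theorem skew_weightedShiftOp_shiftOp {r : F} (hr : r ≠ 0) (s : L) :
    Skew r⁻¹ (weightedShiftOp r s) (shiftOp L) := by
  refine LinearMap.ext fun f => funext fun n => ?_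
  simp only [Module.End.mul_apply, LinearMap.smul_apply, Pi.smul_apply, shiftOp_apply,
    weightedShiftOp_apply, smul_smul]
  rw [zpow_add_one₀ hr, mul_comm (r ^ n), inv_mul_cancel_left₀ hr,
    show n - 2 + 1 = n + 1 - 2 by ring]

/-- The two unit shifts cancel the double backward shift, and `r ^ n * t ^ n = 1` removes the
dependence on the index; this is how `Z` and `C` come to act by scalars. -/
theorem shiftOp_mul_weightedShiftOp_mul_shiftOp_mul_diagonalOp {r t : F} (hr : r ≠ 0)
    (hrt : r * t = 1) (s : L) :
    shiftOp L * weightedShiftOp r s * shiftOp L * diagonalOp L t = algebraMap L _ (r • s) := by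
  refine LinearMap.ext fun f => funext fun n => ?_
  simp only [Module.End.mul_apply, shiftOp_apply, diagonalOp_apply,
    weightedShiftOp_apply, Module.algebraMap_end_apply, Pi.smul_apply, smul_eq_mul, mul_smul_comm,
    smul_mul_assoc, smul_smul]
  rw [show n + 1 - 2 + 1 = n by ring, zpow_add_one₀ hr, mul_right_comm, ← mul_zpow, hrt, one_zpow,
    one_mul]

end Representation

/-! ### Representations of the factor algebras with prescribed central character. -/

section Representations

variable {F : Type u} [Field F] {q : F}

theorem exists_representation_mod_X (hq0 : q ≠ 0) (hq : ∀ n : ℕ, 0 < n → q ^ n ≠ 1)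
    (L : Type u) [CommRing L] [Algebra F L] (t : L) :
    ∃ ρ : (idealX F q).ringCon.Quotient →ₐ[F] Module.End L (ℤ → L),
      ρ (elZ F q) = algebraMap L _ t := by
  have hc : (q⁻¹ - q) * q ≠ 0 := mul_ne_zero (ageingSystem hq0 hq).sub_ne_zero' hq0
  -- With `X` acting as `0`, `Z` is `(q⁻¹ - q) Y E Y K⁻¹` and acts by `(q⁻¹ - q) * q` times `s`;
  -- this choice makes the scalar `t`.
  set s : L := ((q⁻¹ - q) * q)⁻¹ • t with hs
  obtain ⟨ρ, hE, hK, hK', hX, hY⟩ := exists_algHom (q := q) (weightedShiftOp q s) (diagonalOp L q)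
    (diagonalOp L q⁻¹) 0 (shiftOp L) (diagonalOp_mul_inv hq0) (diagonalOp_inv_mul hq0)
    (skew_weightedShiftOp_diagonalOp hq0 q s) (by simp) (skew_shiftOp_diagonalOp hq0) (by simp)
    (by rw [zero_add]; exact skew_weightedShiftOp_shiftOp hq0 s) (by simp)
  have hker : idealX F q ≤ TwoSidedIdeal.ker ρ := by
    rw [idealX, TwoSidedIdeal.span_le, Set.singleton_subset_iff, SetLike.mem_coe,
      TwoSidedIdeal.mem_ker, hX]
  obtain ⟨ρ', hρ'⟩ := exists_algHom_quotient _ ρ fun x hx => (TwoSidedIdeal.mem_ker ρ).1 (hker hx)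
  refine ⟨ρ', ?_⟩
  rw [elZ, hρ', elPhi, map_mul, map_mul, map_add, map_smul, map_mul, hE, hK', hX, hY, zero_add,
    smul_mul_assoc, smul_mul_assoc, shiftOp_mul_weightedShiftOp_mul_shiftOp_mul_diagonalOp hq0
      (mul_inv_cancel₀ hq0), ← algebraMap.coe_smul, smul_smul, hs, smul_inv_smul₀ hc]

theorem exists_representation_mod_Phi (hq0 : q ≠ 0) (hq : ∀ n : ℕ, 0 < n → q ^ n ≠ 1)
    (L : Type u) [CommRing L] [Algebra F L] (t : L) :
    ∃ ρ : (idealPhi F q).ringCon.Quotient →ₐ[F] Module.End L (ℤ → L),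
      ρ (elC F q) = algebraMap L _ t := by
  have hq0' := inv_ne_zero hq0
  have hc : (-(q⁻¹ - q)) * q⁻¹ ≠ 0 :=
    mul_ne_zero (neg_ne_zero.2 (ageingSystem hq0 hq).sub_ne_zero') hq0'
  -- Here `φ = 0` forces `X = -(q⁻¹ - q) Y E`, so `C` acts by `-(q⁻¹ - q) * q⁻¹` times `s`.
  set s : L := ((-(q⁻¹ - q)) * q⁻¹)⁻¹ • t with hs
  set e := weightedShiftOp q⁻¹ s
  set y := shiftOp L
  have hek : Skew (q⁻¹ ^ 2) e (diagonalOp L q) := skew_weightedShiftOp_diagonalOp hq0 q⁻¹ s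
  have hyk : Skew q y (diagonalOp L q) := skew_shiftOp_diagonalOp hq0
  have hey : Skew q e y := by
    have := skew_weightedShiftOp_shiftOp hq0' s
    rwa [inv_inv] at this
  have hxk : -(q⁻¹ - q) • (y * e) * diagonalOp L q =
      q⁻¹ • (diagonalOp L q * -(q⁻¹ - q) • (y * e)) := by
    have := hyk.mul_left hek
    rw [show q * q⁻¹ ^ 2 = q⁻¹ by field_simp] at this
    rw [smul_mul_assoc, this, mul_smul_comm, smul_comm]
  have hex : e * -(q⁻¹ - q) • (y * e) = q • (-(q⁻¹ - q) • (y * e) * e) := by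
    have := (hey.mul_right (Skew.refl e)).smul_right (-(q⁻¹ - q))
    rw [mul_one] at this
    exact this
  have hey' : e * y = -(q⁻¹ - q) • (y * e) + q⁻¹ • (y * e) := by
    rw [← add_smul, show -(q⁻¹ - q) + q⁻¹ = q by ring]
    exact hey
  have hyx : q • (y * -(q⁻¹ - q) • (y * e)) = -(q⁻¹ - q) • (y * e) * y := by
    rw [mul_smul_comm, smul_mul_assoc, mul_assoc y e y, hey, mul_smul_comm, smul_comm]
  obtain ⟨ρ, hE, hK, hK', hX, hY⟩ := exists_algHom (q := q) e (diagonalOp L q)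
    (diagonalOp L q⁻¹) (-(q⁻¹ - q) • (y * e)) y (diagonalOp_mul_inv hq0) (diagonalOp_inv_mul hq0)
    hek hxk hyk hex hey' hyx
  have hker : idealPhi F q ≤ TwoSidedIdeal.ker ρ := by
    rw [idealPhi, TwoSidedIdeal.span_le, Set.singleton_subset_iff, SetLike.mem_coe,
      TwoSidedIdeal.mem_ker, elPhi, map_add, map_smul, map_mul, hX, hE, hY, ← add_smul,
      neg_add_cancel, zero_smul]
  obtain ⟨ρ', hρ'⟩ := exists_algHom_quotient _ ρ fun x hx => (TwoSidedIdeal.mem_ker ρ).1 (hker hx)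
  refine ⟨ρ', ?_⟩
  rw [elC, hρ', map_mul, map_mul, hK, hX, hY,
    smul_mul_assoc, smul_mul_assoc, shiftOp_mul_weightedShiftOp_mul_shiftOp_mul_diagonalOp hq0'
      (inv_mul_cancel₀ hq0), ← algebraMap.coe_smul, smul_smul, hs, smul_inv_smul₀ hc]

end Representations

end QuantumAgeing

/-! ### The three families of maximal ideals. -/

namespace QuantumAgeing

universe u

variable {F : Type u} [Field F] {q : F}

theorem quantumTriple_mod_X (hq0 : q ≠ 0) (hq : ∀ n : ℕ, 0 < n → q ^ n ≠ 1) :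
    ∃ (p c : F) (k : (idealX F q).ringCon.Quotientˣ), QuantumTriple p c k
      ((idealX F q).ringCon.mk' (elY F q)) ((idealX F q).ringCon.mk' (elE F q)) (elZ F q) := by
  have h := (ageingSystem hq0 hq).map (quotientMap F (idealX F q))
    (quotientMap_surjective F (idealX F q))
  have h0 : quotientMap F (idealX F q) (elX F q) = 0 :=
    (quotientMap_eq_zero_iff _ _ _).2 (TwoSidedIdeal.subset_span rfl)
  exact ⟨_, _, _, h.quantumTriple_of_x_eq_zero h0⟩

theorem quantumTriple_mod_Phi (hq0 : q ≠ 0) (hq : ∀ n : ℕ, 0 < n → q ^ n ≠ 1) :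
    ∃ (p c : F) (k : (idealPhi F q).ringCon.Quotientˣ), QuantumTriple p c k
      ((idealPhi F q).ringCon.mk' (elY F q)) ((idealPhi F q).ringCon.mk' (elE F q))
      (elC F q) := by
  have h := (ageingSystem hq0 hq).map (quotientMap F (idealPhi F q))
    (quotientMap_surjective F (idealPhi F q))
  have h0 : quotientMap F (idealPhi F q) (elPhi F q) = 0 :=
    (quotientMap_eq_zero_iff _ _ _).2 (TwoSidedIdeal.subset_span rfl)
  exact ⟨_, _, _, h.quantumTriple_of_phi_eq_zero h0⟩

/-- Besides maximality, the two membership facts are recorded because they separate the families. -/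
theorem isCoatom_of_mem_familyQ (hq0 : q ≠ 0) (hq : ∀ n : ℕ, 0 < n → q ^ n ≠ 1)
    {M : TwoSidedIdeal (Alg F q)} (hM : M ∈ familyQ F q) :
    IsCoatom M ∧ elX F q ∈ M ∧ elPhi F q * elY F q * elKinv F q ∉ M := by
  obtain ⟨𝔮, hm, hne, rfl⟩ := hM
  obtain ⟨p, c, k, h⟩ := quantumTriple_mod_X hq0 hq
  have h1 := one_notMem_span_of_representation (exists_representation_mod_X hq0 hq) hm.ne_top
  refine ⟨(isCoatom_comap_iff _ (RingCon.mk'_surjective _)).2 (h.isCoatom_span hm hne h1), ?_, ?_⟩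
  · rw [idealXq, TwoSidedIdeal.mem_comap,
      (mk'_eq_zero_iff (idealX F q) (elX F q)).2 (TwoSidedIdeal.subset_span rfl)]
    exact TwoSidedIdeal.zero_mem _
  · rw [idealXq, TwoSidedIdeal.mem_comap]
    exact generator_notMem_span hm hne h1

theorem isCoatom_of_mem_familyR (hq0 : q ≠ 0) (hq : ∀ n : ℕ, 0 < n → q ^ n ≠ 1)
    {M : TwoSidedIdeal (Alg F q)} (hM : M ∈ familyR F q) :
    IsCoatom M ∧ elPhi F q ∈ M ∧ elX F q * elY F q * elK F q ∉ M := by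
  obtain ⟨𝔮, hm, hne, rfl⟩ := hM
  obtain ⟨p, c, k, h⟩ := quantumTriple_mod_Phi hq0 hq
  have h1 := one_notMem_span_of_representation (exists_representation_mod_Phi hq0 hq) hm.ne_top
  refine ⟨(isCoatom_comap_iff _ (RingCon.mk'_surjective _)).2 (h.isCoatom_span hm hne h1), ?_, ?_⟩
  · rw [idealPhir, TwoSidedIdeal.mem_comap,
      (mk'_eq_zero_iff (idealPhi F q) (elPhi F q)).2 (TwoSidedIdeal.subset_span rfl)]
    exact TwoSidedIdeal.zero_mem _
  · rw [idealPhir, TwoSidedIdeal.mem_comap]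
    exact generator_notMem_span hm hne h1

theorem exists_isCoatom_comap_eq {R : Type u} [Ring R] {J M : TwoSidedIdeal R} (hJ : J ≤ M)
    (hM : IsCoatom M) : ∃ N : TwoSidedIdeal J.ringCon.Quotient,
      IsCoatom N ∧ M = N.comap J.ringCon.mk' ∧ ∀ x, J.ringCon.mk' x ∈ N ↔ x ∈ M := by
  obtain ⟨N, rfl⟩ := exists_comap_eq J.ringCon.mk' J.ringCon.mk'_surjective M
    fun x hx => hJ ((mk'_eq_zero_iff J x).1 hx)
  exact ⟨N, (isCoatom_comap_iff _ (RingCon.mk'_surjective _)).1 hM, rfl,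
    fun x => (TwoSidedIdeal.mem_comap _).symm⟩

theorem mem_familyQ_of_X_mem (hq0 : q ≠ 0) (hq : ∀ n : ℕ, 0 < n → q ^ n ≠ 1)
    {M : TwoSidedIdeal (Alg F q)} (hM : IsCoatom M) (hX : elX F q ∈ M) (hY : elY F q ∉ M)
    (hE : elE F q ∉ M) : M ∈ familyQ F q := by
  obtain ⟨p, c, k, h⟩ := quantumTriple_mod_X hq0 hq
  obtain ⟨N, hN, rfl, hmem⟩ := exists_isCoatom_comap_eq (J := idealX F q)
    (TwoSidedIdeal.span_le.2 (Set.singleton_subset_iff.2 hX)) hM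
  obtain ⟨𝔮, hm, hne, rfl⟩ := h.exists_eq_span hN (mt (hmem _).1 hY) (mt (hmem _).1 hE)
  exact ⟨𝔮, hm, hne, rfl⟩

theorem mem_familyR_of_Phi_mem (hq0 : q ≠ 0) (hq : ∀ n : ℕ, 0 < n → q ^ n ≠ 1)
    {M : TwoSidedIdeal (Alg F q)} (hM : IsCoatom M) (hφ : elPhi F q ∈ M) (hY : elY F q ∉ M)
    (hE : elE F q ∉ M) : M ∈ familyR F q := by
  obtain ⟨p, c, k, h⟩ := quantumTriple_mod_Phi hq0 hq
  obtain ⟨N, hN, rfl, hmem⟩ := exists_isCoatom_comap_eq (J := idealPhi F q)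
    (TwoSidedIdeal.span_le.2 (Set.singleton_subset_iff.2 hφ)) hM
  obtain ⟨𝔮, hm, hne, rfl⟩ := h.exists_eq_span hN (mt (hmem _).1 hY) (mt (hmem _).1 hE)
  exact ⟨𝔮, hm, hne, rfl⟩

theorem commute_algK (a b : algK F q) : a * b = b * a := by
  refine Subtype.ext (Algebra.commute_of_mem_adjoin_of_forall_mem_commute b.2 fun g hg => ?_)
  refine (Algebra.commute_of_mem_adjoin_of_forall_mem_commute a.2 fun g' hg' => ?_).symm
  have h : Commute (elK F q) (elKinv F q) := (Commute.refl (unitK F q : Alg F q)).units_inv_right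
  obtain rfl | rfl := hg <;> obtain rfl | rfl := hg'
  exacts [Commute.refl _, h, h.symm, Commute.refl _]

/-- The retraction of the algebra onto `F[K, K⁻¹]` with kernel `(Y, E)`. -/
theorem exists_retraction (F : Type u) [Field F] (q : F) : ∃ ρ : Alg F q →ₐ[F] algK F q,
    ρ (elE F q) = 0 ∧ ρ (elY F q) = 0 ∧ (∀ s : algK F q, ρ s = s) ∧
      ∀ a, a - ρ a ∈ TwoSidedIdeal.span {elY F q, elE F q} := by
  have hK : elK F q ∈ algK F q := Algebra.subset_adjoin (by simp)
  have hK' : elKinv F q ∈ algK F q := Algebra.subset_adjoin (by simp)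
  obtain ⟨ρ, hρE, hρK, hρK', hρX, hρY⟩ := exists_algHom (q := q) (0 : algK F q) ⟨_, hK⟩ ⟨_, hK'⟩ 0 0
    (Subtype.ext (unitK F q).val_inv) (Subtype.ext (unitK F q).inv_val) (by simp) (by simp)
    (by simp) (by simp) (by simp) (by simp)
  refine ⟨ρ, hρE, hρY, ?_, ?_⟩
  · rintro ⟨s, hs⟩
    induction hs using Algebra.adjoin_induction with
    | mem g hg =>
      obtain rfl | rfl := hg
      exacts [hρK, hρK']
    | algebraMap r => exact ρ.commutes r
    | add a b _ _ ha hb => exact (map_add ρ a b).trans (congrArg₂ (· + ·) ha hb)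
    | mul a b _ _ ha hb => exact (map_mul ρ a b).trans (congrArg₂ (· * ·) ha hb)
  · intro a
    set I : TwoSidedIdeal (Alg F q) := TwoSidedIdeal.span {elY F q, elE F q}
    have hY : elY F q ∈ I := TwoSidedIdeal.subset_span (by simp)
    have hE : elE F q ∈ I := TwoSidedIdeal.subset_span (by simp)
    have ha : a ∈ Algebra.adjoin F {elK F q, elKinv F q, elE F q, elX F q, elY F q} := by
      rw [adjoin_generators]; trivial
    induction ha using Algebra.adjoin_induction with
    | mem g hg =>
      obtain rfl | rfl | rfl | rfl | rfl := hg
      · rw [hρK, sub_self]; exact I.zero_mem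
      · rw [hρK', sub_self]; exact I.zero_mem
      · rw [hρE, ZeroMemClass.coe_zero, sub_zero]; exact hE
      -- Although `X` is not among the generators of this ideal, the relation between `E` and `Y`
      -- puts it there.
      · have hXeq : elX F q = elE F q * elY F q - q⁻¹ • (elY F q * elE F q) := by
          have := RingQuot.mkAlgHom_rel F (Rel.E_mul_Y (F := F) (q := q))
          rw [map_mul, map_add, map_smul, map_mul] at this
          exact eq_sub_of_add_eq this.symm
        rw [hρX, ZeroMemClass.coe_zero, sub_zero, hXeq]
        exact I.sub_mem (I.mul_mem_left _ _ hY) (smul_mem_ideal I _ (I.mul_mem_left _ _ hE))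
      · rw [hρY, ZeroMemClass.coe_zero, sub_zero]; exact hY
    | algebraMap r =>
      rw [AlgHom.commutes, Subalgebra.coe_algebraMap, sub_self]; exact I.zero_mem
    | add a b _ _ ha hb =>
      rw [map_add, Subalgebra.coe_add, add_sub_add_comm]
      exact I.add_mem ha hb
    | mul a b _ _ ha hb =>
      have : a * b - (ρ (a * b) : Alg F q) = (a - ρ a) * b + ρ a * (b - ρ b) := by
        rw [map_mul, Subalgebra.coe_mul, sub_mul, mul_sub, sub_add_sub_cancel]
      rw [this]
      exact I.add_mem (I.mul_mem_right _ _ ha) (I.mul_mem_left _ _ hb)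

/-- The preimage of `𝔭` under the retraction is two-sided because `F[K, K⁻¹]` is commutative, and it
contains the generators; conversely `a` differs from `ρ a` by an element of `(Y, E)`. -/
theorem mem_idealYE_iff {ρ : Alg F q →ₐ[F] algK F q} (hE : ρ (elE F q) = 0)
    (hY : ρ (elY F q) = 0) (hs : ∀ s : algK F q, ρ s = s)
    (hker : ∀ a, a - ρ a ∈ TwoSidedIdeal.span {elY F q, elE F q}) (𝔭 : Ideal (algK F q))
    (a : Alg F q) : a ∈ idealYE F q 𝔭 ↔ ρ a ∈ 𝔭 := by
  constructor
  · let J : TwoSidedIdeal (Alg F q) := TwoSidedIdeal.mk' {a | ρ a ∈ 𝔭}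
      (by rw [Set.mem_ofPred_eq, map_zero]; exact 𝔭.zero_mem)
      (fun {a b} ha hb => by rw [Set.mem_ofPred_eq, map_add]; exact 𝔭.add_mem ha hb)
      (fun {a} ha => by
        have h : ρ (-a) = ρ (-1) * ρ a :=
          (congrArg ρ (neg_one_mul a).symm).trans (map_mul ρ (-1) a)
        exact Eq.subst (motive := (· ∈ 𝔭)) h.symm (𝔭.mul_mem_left _ ha))
      (fun {a b} hb => by rw [Set.mem_ofPred_eq, map_mul]; exact 𝔭.mul_mem_left _ hb)
      (fun {a b} ha => by
        rw [Set.mem_ofPred_eq, map_mul, commute_algK]; exact 𝔭.mul_mem_left _ ha)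
    have hJ : ∀ a, a ∈ J ↔ ρ a ∈ 𝔭 := fun a => TwoSidedIdeal.mem_mk' _ _ _ _ _ _ _
    rw [← hJ]
    refine fun ha => (TwoSidedIdeal.span_le (I := J)).2 ?_ ha
    rintro _ ((rfl | rfl) | ⟨s, hs𝔭, rfl⟩)
    · rw [SetLike.mem_coe, hJ, hY]; exact 𝔭.zero_mem
    · rw [SetLike.mem_coe, hJ, hE]; exact 𝔭.zero_mem
    · rw [SetLike.mem_coe, hJ, hs]; exact hs𝔭
  · intro ha
    rw [← sub_add_cancel a (ρ a : Alg F q)]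
    exact TwoSidedIdeal.add_mem _ (TwoSidedIdeal.span_mono Set.subset_union_left (hker a))
      (TwoSidedIdeal.subset_span (Or.inr ⟨_, ha, rfl⟩))

theorem isCoatom_of_mem_familyP {M : TwoSidedIdeal (Alg F q)} (hM : M ∈ familyP F q) :
    IsCoatom M ∧ elY F q ∈ M := by
  obtain ⟨𝔭, hm, rfl⟩ := hM
  obtain ⟨ρ, hE, hY, hs, hker⟩ := exists_retraction F q
  have hmem := mem_idealYE_iff hE hY hs hker 𝔭
  refine ⟨⟨fun h => hm.ne_top ?_, fun I hI => ?_⟩, TwoSidedIdeal.subset_span (by simp)⟩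
  · rw [← TwoSidedIdeal.one_mem_iff, hmem, map_one] at h
    exact (Ideal.eq_top_iff_one _).2 h
  · obtain ⟨a, haI, ha⟩ := SetLike.exists_of_lt hI
    rw [hmem] at ha
    obtain ⟨s, b, hb, hsb⟩ := exists_mul_add_eq_one hm ha
    rw [← TwoSidedIdeal.one_mem_iff]
    have h1 : 1 - (s : Alg F q) * a ∈ idealYE F q 𝔭 := by
      rw [hmem, map_sub, map_mul, map_one, hs, sub_eq_of_eq_add' hsb.symm]; exact hb
    have := I.add_mem (I.mul_mem_left s _ haI) (hI.le h1)
    rwa [add_sub_cancel] at this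

theorem mem_familyP_of_mem {M : TwoSidedIdeal (Alg F q)} (hM : IsCoatom M)
    (hYM : elY F q ∈ M) (hEM : elE F q ∈ M) : M ∈ familyP F q := by
  obtain ⟨ρ, hE, hY, hs, hker⟩ := exists_retraction F q
  have hle : TwoSidedIdeal.span {elY F q, elE F q} ≤ M := by
    rw [TwoSidedIdeal.span_le]
    rintro _ (rfl | rfl)
    exacts [hYM, hEM]
  set 𝔭 : Ideal (algK F q) := (TwoSidedIdeal.asIdeal M).comap (algK F q).val with h𝔭
  have hmem : ∀ s, s ∈ 𝔭 ↔ (s : Alg F q) ∈ M := fun s => Iff.rfl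
  have hM𝔭 : ∀ a, a ∈ M ↔ ρ a ∈ 𝔭 := fun a => by
    rw [hmem]
    have := hle (hker a)
    exact ⟨fun h => by simpa using M.sub_mem h this, fun h => by simpa using M.add_mem this h⟩
  refine ⟨𝔭, ⟨⟨fun h => hM.1 ?_, fun I hI => ?_⟩⟩, ?_⟩
  · rw [← TwoSidedIdeal.one_mem_iff, hM𝔭, h]; trivial
  · have hlt : M < idealYE F q I := by
      obtain ⟨s, hsI, hs𝔭⟩ := SetLike.exists_of_lt hI
      refine lt_of_le_of_ne (fun a ha => ?_) fun he => hs𝔭 ?_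
      · rw [mem_idealYE_iff hE hY hs hker]
        exact hI.le ((hM𝔭 a).1 ha)
      · rw [hmem, he, mem_idealYE_iff hE hY hs hker, hs]
        exact hsI
    have h1 := (TwoSidedIdeal.one_mem_iff _).2 (hM.2 _ hlt)
    rw [mem_idealYE_iff hE hY hs hker, map_one] at h1
    exact (Ideal.eq_top_iff_one _).2 h1
  · ext a
    rw [mem_idealYE_iff hE hY hs hker, hM𝔭]

theorem X_mem_or_Phi_mem (hq0 : q ≠ 0) (hq : ∀ n : ℕ, 0 < n → q ^ n ≠ 1)
    {M : TwoSidedIdeal (Alg F q)} (hM : IsCoatom M) :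
    (elX F q ∈ M ∨ elPhi F q ∈ M) ∧ (elE F q ∈ M ↔ elY F q ∈ M) := by
  have : IsSimpleRing M.ringCon.Quotient := (isSimpleRing_quotient_iff M).2 hM
  have h := (ageingSystem hq0 hq).map (quotientMap F M) (quotientMap_surjective F M)
  have hπ := quotientMap_eq_zero_iff F M
  have h1 := h.x_eq_zero_or_phi_eq_zero
  rw [← map_mul, ← map_smul, ← map_add, hπ, hπ] at h1
  exact ⟨h1, by rw [← hπ, ← hπ]; exact h.e_eq_zero_iff⟩

end QuantumAgeing

theorem corollary2 (F : Type*) [Field F] (q : F) (hq0 : q ≠ 0)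
    (hq : ∀ n : ℕ, 0 < n → q ^ n ≠ 1) :
    QuantumAgeing.maxIdeals F q =
        QuantumAgeing.familyP F q ∪ QuantumAgeing.familyQ F q ∪ QuantumAgeing.familyR F q ∧
      Disjoint (QuantumAgeing.familyP F q) (QuantumAgeing.familyQ F q) ∧
      Disjoint (QuantumAgeing.familyP F q) (QuantumAgeing.familyR F q) ∧
      Disjoint (QuantumAgeing.familyQ F q) (QuantumAgeing.familyR F q) := by
  refine ⟨Set.ext fun M => ⟨fun hM => ?_, ?_⟩, ?_, ?_, ?_⟩
  · obtain ⟨h, hEY⟩ := QuantumAgeing.X_mem_or_Phi_mem hq0 hq hM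
    by_cases hY : QuantumAgeing.elY F q ∈ M
    · exact Or.inl (Or.inl (QuantumAgeing.mem_familyP_of_mem hM hY (hEY.2 hY)))
    · obtain hX | hφ := h
      · exact Or.inl (Or.inr (QuantumAgeing.mem_familyQ_of_X_mem hq0 hq hM hX hY (mt hEY.1 hY)))
      · exact Or.inr (QuantumAgeing.mem_familyR_of_Phi_mem hq0 hq hM hφ hY (mt hEY.1 hY))
  · rintro ((h | h) | h)
    exacts [(QuantumAgeing.isCoatom_of_mem_familyP h).1,
      (QuantumAgeing.isCoatom_of_mem_familyQ hq0 hq h).1,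
      (QuantumAgeing.isCoatom_of_mem_familyR hq0 hq h).1]
  -- `Y ∈ M` puts `φ Y K⁻¹` in `M`, contradicting that `Z` is not killed; the next case is the same
  -- with `X Y K`.
  · refine Set.disjoint_left.2 fun M hP hQ => ?_
    obtain ⟨-, -, h⟩ := QuantumAgeing.isCoatom_of_mem_familyQ hq0 hq hQ
    exact h (M.mul_mem_right _ _ (M.mul_mem_left _ _ (QuantumAgeing.isCoatom_of_mem_familyP hP).2))
  · refine Set.disjoint_left.2 fun M hP hR => ?_
    obtain ⟨-, -, h⟩ := QuantumAgeing.isCoatom_of_mem_familyR hq0 hq hR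
    exact h (M.mul_mem_right _ _ (M.mul_mem_left _ _ (QuantumAgeing.isCoatom_of_mem_familyP hP).2))
  -- `X ∈ M` puts `X Y K` in `M`, whereas `C` survives in the third family.
  · refine Set.disjoint_left.2 fun M hQ hR => ?_
    obtain ⟨-, hX, -⟩ := QuantumAgeing.isCoatom_of_mem_familyQ hq0 hq hQ
    obtain ⟨-, -, h⟩ := QuantumAgeing.isCoatom_of_mem_familyR hq0 hq hR
    exact h (M.mul_mem_right _ _ (M.mul_mem_right _ _ hX))
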